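/- Let $F$ be a totally real number field with ring of integers $\mathcal{O}$, and let $B$ be a totally definite quaternion algebra over $F$, i.e. $B\otimes_{F,\tau}\mathbb{R}$ is a division algebra for every embedding $\tau:F\to\mathbb{R}$. Let $R$ be an Eichler order in $B$ (an intersection of two maximal orders), and let $\mathfrak{I}(R)$ be the set of invertible (i.e. locally principal) left $R$-ideals. Two ideals $I,J\in\mathfrak{I}(R)$ are equivalent if $I=Jx$ for some $x\in B^\times$; write $[I]$ for the class of $I$ and $\mathrm{Cl}(R)$ for the set of classes. Let $M(R)$ be the complex vector space with basis $\mathrm{Cl}(R)$, with the inner product given by the sesquilinear extension of $$\langle [I],[J]\rangle=\#\{x\in\mathcal{O}^\times\backslash B^\times : Ix=J\}.$$ For a nonzero ideal $\mathfrak{m}$ of $\mathcal{O}$ let $T_{\mathfrak{m}}$ be the linear operator on $M(R)$ with $$T_{\mathfrak{m}}([I])=\sum_{J\in t_{\mathfrak{m}}(I)}[J],\qquad t_{\mathfrak{m}}(I)=\{J\in\mathfrak{I}(R): J\subseteq I,\ [I:J]=\mathfrak{m}^2\},$$ where $[I:J]$ is the $\mathcal{O}$-module index, an ideal of $\mathcal{O}$: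 the $\mathcal{O}$-submodule of $F$ generated by the determinants of the $F$-linear maps $\delta:B\to B$ with $\delta(I)\subseteq J$. The ideal class group $\mathrm{Cl}(F)$ acts linearly on $M(R)$ by $[\mathfrak{a}][I]=[\mathfrak{a}I]$. Then the adjoint of $T_{\mathfrak{m}}$ with respect to $\langle\,,\,\rangle$ is $[\mathfrak{m}^{-1}]T_{\mathfrak{m}}$. That is, a linear operator $S$ on $M(R)$ satisfies $\langle T_{\mathfrak{m}}u,v\rangle=\langle u,Sv\rangle$ for all $u,v\in M(R)$ if and only if $S=[\mathfrak{m}^{-1}]T_{\mathfrak{m}}$. -/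

import Mathlib

open NumberField IsDedekindDomain
open scoped nonZeroDivisors Quaternion TensorProduct ComplexConjugate Pointwise

set_option linter.unusedSectionVars false

noncomputable section

namespace QuaternionicModular

section Algebras

variable (F : Type*) [Field F] (B : Type*) [Ring B] [Algebra F B]

/-- `B` is a quaternion algebra over `F` (of characteristic different from two): it has a basis
`1, i, j, ij` with `i ^ 2 = a`, `j ^ 2 = b`, `j * i = - i * j`, where `a` and `b` are nonzero. -/
def IsQuaternionAlgebra : Prop :=
  ∃ a b : F, a ≠ 0 ∧ b ≠ 0 ∧ Nonempty (ℍ[F, a, b] ≃ₐ[F] B)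

/-- `B` is ramified at every real embedding `τ`: the algebra `ℝ ⊗ B`, where `ℝ` is an
`F`-algebra through `τ`, is a division algebra. -/
def IsTotallyDefinite : Prop :=
  ∀ τ : F →+* ℝ, letI : Algebra F ℝ := τ.toAlgebra
    ∀ x : ℝ ⊗[F] B, x ≠ 0 → IsUnit x

end Algebras

variable {F : Type*} [Field F] [NumberField F] {B : Type*} [Ring B] [Algebra F B]

/-- An order of `B`: a subring that contains `𝓞 F`, is finitely generated as an `𝓞 F`-module,
and spans `B` over `F`. -/
def IsOrder (S : Subalgebra (𝓞 F) B) : Prop :=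
  (Subalgebra.toSubmodule S).FG ∧ Submodule.span F (S : Set B) = ⊤

/-- An Eichler order: the intersection of two (not necessarily distinct) maximal orders. -/
def IsEichlerOrder (R : Subalgebra (𝓞 F) B) : Prop :=
  ∃ S₁ S₂ : Subalgebra (𝓞 F) B, Maximal IsOrder S₁ ∧ Maximal IsOrder S₂ ∧ R = S₁ ⊓ S₂

/-- The localization, inside `B`, of an `𝓞 F`-submodule of `B` at the prime `p`. -/
def localAt (p : HeightOneSpectrum (𝓞 F)) (M : Submodule (𝓞 F) B) : Submodule (𝓞 F) B where
  carrier := {b | ∃ s : 𝓞 F, s ∉ p.asIdeal ∧ s • b ∈ M}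
  zero_mem' := ⟨1, fun h => p.isPrime.ne_top ((Ideal.eq_top_iff_one _).2 h), by simp⟩
  add_mem' := by
    rintro a b ⟨s, hs, ha⟩ ⟨t, ht, hb⟩
    refine ⟨s * t, fun h => (p.isPrime.mem_or_mem h).elim hs ht, ?_⟩
    rw [smul_add]
    refine M.add_mem ?_ ?_
    · rw [mul_comm, mul_smul]; exact M.smul_mem _ ha
    · rw [mul_smul]; exact M.smul_mem _ hb
  smul_mem' := by
    rintro c b ⟨s, hs, hb⟩
    exact ⟨s, hs, by rw [smul_comm]; exact M.smul_mem _ hb⟩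

/-- The right translate `M x`. -/
def rmul (M : Submodule (𝓞 F) B) (x : Bˣ) : Submodule (𝓞 F) B :=
  M.map (LinearMap.mulRight (𝓞 F) (x : B))

theorem mem_rmul {M : Submodule (𝓞 F) B} {x : Bˣ} {b : B} :
    b ∈ rmul M x ↔ b * ((x⁻¹ : Bˣ) : B) ∈ M := by
  constructor
  · rintro ⟨a, ha, rfl⟩
    simpa using ha
  · intro h
    exact ⟨_, h, by simp⟩

@[simp] theorem rmul_one (M : Submodule (𝓞 F) B) : rmul M 1 = M := by
  ext b; simp [mem_rmul]

theorem rmul_rmul (M : Submodule (𝓞 F) B) (x y : Bˣ) : rmul (rmul M x) y = rmul M (x * y) := by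
  ext b; simp [mem_rmul, mul_assoc]

theorem rmul_mono {M N : Submodule (𝓞 F) B} (h : M ≤ N) (x : Bˣ) : rmul M x ≤ rmul N x :=
  Submodule.map_mono h

theorem localAt_rmul (p : HeightOneSpectrum (𝓞 F)) (M : Submodule (𝓞 F) B) (x : Bˣ) :
    localAt p (rmul M x) = rmul (localAt p M) x := by
  ext b
  rw [mem_rmul]
  change (∃ s : 𝓞 F, s ∉ p.asIdeal ∧ s • b ∈ rmul M x) ↔
    ∃ s : 𝓞 F, s ∉ p.asIdeal ∧ s • (b * ((x⁻¹ : Bˣ) : B)) ∈ M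
  simp only [mem_rmul, smul_mul_assoc]

/-- The invertible left ideals of `R`: the finitely generated `𝓞 F`-submodules `I` of `B` with
`R I ⊆ I` that are locally principal, that is `I_p = R_p x_p` with `x_p` a unit of `B`, for every
nonzero prime `p`. -/
def IsInvertibleLeftIdeal (R : Subalgebra (𝓞 F) B) (I : Submodule (𝓞 F) B) : Prop :=
  I.FG ∧ (∀ r ∈ R, ∀ b ∈ I, r * b ∈ I) ∧
    ∀ p : HeightOneSpectrum (𝓞 F), ∃ x : Bˣ, localAt p I = rmul (localAt p R.toSubmodule) x

/-- The set of invertible left ideals of `R`. -/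
abbrev LeftIdeals (R : Subalgebra (𝓞 F) B) : Type _ :=
  {I : Submodule (𝓞 F) B // IsInvertibleLeftIdeal R I}

variable {R : Subalgebra (𝓞 F) B}

/-- The right translate `I x` of an invertible left ideal. -/
def LeftIdeals.rmul (I : LeftIdeals R) (x : Bˣ) : LeftIdeals R :=
  ⟨QuaternionicModular.rmul I.1 x, I.2.1.map _, fun r hr b hb => by
      rw [mem_rmul] at hb ⊢
      rw [mul_assoc]
      exact I.2.2.1 r hr _ hb,
    fun p => by
      obtain ⟨y, hy⟩ := I.2.2.2 p
      exact ⟨y * x, by rw [localAt_rmul, hy, rmul_rmul]⟩⟩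

theorem LeftIdeals.rmul_rmul (I : LeftIdeals R) (x y : Bˣ) :
    (I.rmul x).rmul y = I.rmul (x * y) :=
  Subtype.ext (QuaternionicModular.rmul_rmul _ _ _)

@[simp] theorem LeftIdeals.rmul_one (I : LeftIdeals R) : I.rmul 1 = I :=
  Subtype.ext (QuaternionicModular.rmul_one _)

/-- The equivalence of ideals: `I = J x` for some `x` in `Bˣ`. -/
def idealSetoid (R : Subalgebra (𝓞 F) B) : Setoid (LeftIdeals R) where
  r I J := ∃ x : Bˣ, I = J.rmul x
  iseqv :=
    { refl := fun I => ⟨1, by simp⟩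
      symm := by
        rintro I J ⟨x, rfl⟩
        exact ⟨x⁻¹, by simp [LeftIdeals.rmul_rmul]⟩
      trans := by
        rintro I J K ⟨x, rfl⟩ ⟨y, rfl⟩
        exact ⟨y * x, by rw [LeftIdeals.rmul_rmul]⟩ }

/-- The set `Cl(R)` of ideal classes. -/
def IdealClasses (R : Subalgebra (𝓞 F) B) : Type _ := Quotient (idealSetoid R)

/-- The class `[I]`. -/
def cls (I : LeftIdeals R) : IdealClasses R := Quotient.mk (idealSetoid R) I

theorem cls_rmul (I : LeftIdeals R) (x : Bˣ) : cls (I.rmul x) = cls I :=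
  Quotient.sound (s := idealSetoid R) ⟨x, rfl⟩

/-- The space `M(R)` of quaternionic modular forms: the complex vector space with basis `Cl(R)`. -/
abbrev Forms (R : Subalgebra (𝓞 F) B) : Type _ := IdealClasses R →₀ ℂ

/-! ### The inner product -/

variable (F B) in
/-- The image of the units of `𝓞 F` in `Bˣ`. -/
def scalarUnits : Subgroup Bˣ := (Units.map (algebraMap (𝓞 F) B : 𝓞 F →* B)).range

/-- The class of `x` in `(𝓞 F)ˣ \ Bˣ`. -/
def unitCls (x : Bˣ) : Quotient (QuotientGroup.rightRel (scalarUnits F B)) :=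
  Quotient.mk (QuotientGroup.rightRel (scalarUnits F B)) x

/-- The number of `x` in `(𝓞 F)ˣ \ Bˣ` with `I x = J`. -/
def transporterCount (I J : LeftIdeals R) : ℕ :=
  Set.ncard (unitCls (F := F) '' {x : Bˣ | I.rmul x = J})

theorem unitCls_eq_iff {x y : Bˣ} :
    unitCls (F := F) x = unitCls (F := F) y ↔ y * x⁻¹ ∈ scalarUnits F B := by
  unfold unitCls
  rw [Quotient.eq, QuotientGroup.rightRel_apply]

theorem scalarUnits_conj {z : Bˣ} (hz : z ∈ scalarUnits F B) (a : Bˣ) : a * z * a⁻¹ = z := by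
  obtain ⟨u, rfl⟩ := hz
  rw [mul_inv_eq_iff_eq_mul]
  ext
  simpa using (Algebra.commutes (u : 𝓞 F) (a : B)).symm

theorem unitCls_translate {a b x y : Bˣ} :
    unitCls (F := F) (a * x * b) = unitCls (F := F) (a * y * b) ↔
      unitCls (F := F) x = unitCls (F := F) y := by
  rw [unitCls_eq_iff, unitCls_eq_iff]
  have h : a * y * b * (a * x * b)⁻¹ = a * (y * x⁻¹) * a⁻¹ := by group
  rw [h]
  constructor
  · intro hz
    have := scalarUnits_conj hz a⁻¹
    have e : a⁻¹ * (a * (y * x⁻¹) * a⁻¹) * a⁻¹⁻¹ = y * x⁻¹ := by group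
    rw [e] at this
    rwa [this]
  · intro hz
    rwa [scalarUnits_conj hz a]

theorem transporterCount_rmul (I J : LeftIdeals R) (a b : Bˣ) :
    transporterCount (I.rmul a) (J.rmul b) = transporterCount I J := by
  symm
  refine Set.ncard_congr (fun q _ => unitCls (F := F) (a⁻¹ * q.out * b)) ?_ ?_ ?_
  · rintro q ⟨x, hx, rfl⟩
    refine ⟨a⁻¹ * x * b, ?_, ?_⟩
    · change (I.rmul a).rmul _ = J.rmul b
      rw [Set.mem_ofPred_eq] at hx
      rw [← hx, LeftIdeals.rmul_rmul, LeftIdeals.rmul_rmul]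
      congr 1; group
    · exact unitCls_translate.2 (Quotient.out_eq (unitCls (F := F) x)).symm
  · rintro q r - - h
    have := unitCls_translate.1 h
    rwa [unitCls, unitCls, Quotient.out_eq, Quotient.out_eq] at this
  · rintro _ ⟨x, hx, rfl⟩
    refine ⟨unitCls (F := F) (a * x * b⁻¹), ⟨_, ?_, rfl⟩, ?_⟩
    · change I.rmul _ = J
      rw [Set.mem_ofPred_eq] at hx
      rw [← LeftIdeals.rmul_rmul, ← LeftIdeals.rmul_rmul, hx, LeftIdeals.rmul_rmul]
      simp
    · have e : x = a⁻¹ * (a * x * b⁻¹) * b := by group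
      conv_rhs => rw [e]
      exact unitCls_translate.2 (Quotient.out_eq (unitCls (F := F) (a * x * b⁻¹)))

/-- The number `⟨[I], [J]⟩` attached to two ideal classes. -/
def pairing : IdealClasses R → IdealClasses R → ℕ :=
  Quotient.lift₂ (s₁ := idealSetoid R) (s₂ := idealSetoid R) transporterCount (by
    rintro _ _ I J ⟨a, rfl⟩ ⟨b, rfl⟩
    exact transporterCount_rmul I J a b)

/-- The inner product on `M(R)`: the sesquilinear extension of `pairing`. -/
def formInner (u v : Forms R) : ℂ :=
  u.sum fun c a => v.sum fun d b => conj a * b * (pairing c d : ℂ)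

/-! ### The Hecke operators -/

/-- The index `[I : J]` as an `𝓞 F`-submodule of `F`: it is generated by the determinants of the
`F`-linear endomorphisms of `B` that map `I` into `J`. (When `J_p = φ I_p` for an automorphism
`φ` of `B`, it is locally generated at `p` by `det φ`.) -/
def moduleIndex (I J : Submodule (𝓞 F) B) : Submodule (𝓞 F) F :=
  Submodule.span (𝓞 F)
    {d | ∃ δ : B →ₗ[F] B, (∀ b ∈ I, δ b ∈ J) ∧ LinearMap.det δ = d}

theorem moduleIndex_rmul_le (I J : Submodule (𝓞 F) B) (x : Bˣ) :
    moduleIndex I J ≤ moduleIndex (rmul I x) (rmul J x) := by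
  refine Submodule.span_mono ?_
  rintro d ⟨δ, hδ, rfl⟩
  let e : B ≃ₗ[F] B :=
    LinearEquiv.ofLinearMap (LinearMap.mulRight F (x : B)) (LinearMap.mulRight F ((x⁻¹ : Bˣ) : B))
      (by ext b; simp) (by ext b; simp)
  refine ⟨(e : B →ₗ[F] B) ∘ₗ δ ∘ₗ (e.symm : B →ₗ[F] B), fun b hb => ?_, LinearMap.det_conj δ e⟩
  rw [mem_rmul] at hb ⊢
  have := hδ _ hb
  change δ (b * ((x⁻¹ : Bˣ) : B)) * (x : B) * ((x⁻¹ : Bˣ) : B) ∈ J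
  simpa using this

theorem moduleIndex_rmul (I J : Submodule (𝓞 F) B) (x : Bˣ) :
    moduleIndex (rmul I x) (rmul J x) = moduleIndex I J := by
  refine le_antisymm ?_ (moduleIndex_rmul_le I J x)
  have := moduleIndex_rmul_le (rmul I x) (rmul J x) x⁻¹
  simpa [rmul_rmul] using this

/-- The set `t_m(I)` of the invertible left ideals `J ⊆ I` with `[I : J] = m ^ 2`. -/
def heckeSet (m : Ideal (𝓞 F)) (I : LeftIdeals R) : Set (LeftIdeals R) :=
  {J | J.1 ≤ I.1 ∧ moduleIndex I.1 J.1 = IsLocalization.coeSubmodule F (m ^ 2)}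

theorem rmul_mem_heckeSet {m : Ideal (𝓞 F)} {I J : LeftIdeals R} (h : J ∈ heckeSet m I) (x : Bˣ) :
    J.rmul x ∈ heckeSet m (I.rmul x) :=
  ⟨rmul_mono h.1 x, (moduleIndex_rmul I.1 J.1 x).trans h.2⟩

/-- The sum of the classes of the members of `t_m(I)`. -/
def heckeSum (m : Ideal (𝓞 F)) (I : LeftIdeals R) : Forms R :=
  ∑ᶠ J ∈ heckeSet m I, Finsupp.single (cls J) 1

theorem heckeSum_rmul (m : Ideal (𝓞 F)) (I : LeftIdeals R) (x : Bˣ) :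
    heckeSum m (I.rmul x) = heckeSum m I := by
  symm
  refine finsum_mem_eq_of_bijOn (fun J => J.rmul x) ⟨?_, ?_, ?_⟩ ?_
  · exact fun J hJ => rmul_mem_heckeSet hJ x
  · intro J _ K _ h
    have := congrArg (fun L : LeftIdeals R => L.rmul x⁻¹) h
    simpa [LeftIdeals.rmul_rmul] using this
  · intro J hJ
    refine ⟨J.rmul x⁻¹, ?_, by simp [LeftIdeals.rmul_rmul]⟩
    have := rmul_mem_heckeSet hJ x⁻¹
    simpa [LeftIdeals.rmul_rmul] using this
  · intro J _
    rw [cls_rmul]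

/-- The Hecke operator `T_m` on `M(R)`: the linear map with `T_m [I] = ∑ [J]`, where `J` runs
over `t_m(I)`. -/
def heckeOperator (R : Subalgebra (𝓞 F) B) (m : Ideal (𝓞 F)) : Forms R →ₗ[ℂ] Forms R :=
  Finsupp.linearCombination ℂ
    (Quotient.lift (s := idealSetoid R) (heckeSum m) (by
      rintro _ I ⟨x, rfl⟩
      exact heckeSum_rmul m I x))

/-! ### The action of the class group of `F` -/

/-- The fractional ideal `𝔞`, seen inside `B`. -/
def embIdeal (B : Type*) [Ring B] [Algebra F B] (𝔞 : FractionalIdeal (𝓞 F)⁰ F) :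
    Submodule (𝓞 F) B :=
  (𝔞 : Submodule (𝓞 F) F).map (IsScalarTower.toAlgHom (𝓞 F) F B).toLinearMap

theorem embIdeal_mul (𝔞 𝔟 : FractionalIdeal (𝓞 F)⁰ F) :
    embIdeal B (𝔞 * 𝔟) = embIdeal B 𝔞 * embIdeal B 𝔟 := by
  unfold embIdeal
  rw [FractionalIdeal.coe_mul, Submodule.map_mul]

theorem embIdeal_one : embIdeal B (1 : FractionalIdeal (𝓞 F)⁰ F) = 1 := by
  unfold embIdeal
  rw [FractionalIdeal.coe_one, Submodule.map_one]

/-- A nonzero element of `F`, as a unit of `B`. -/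
def scalar (B : Type*) [Ring B] [Algebra F B] (ξ : Fˣ) : Bˣ :=
  Units.map (algebraMap F B : F →* B) ξ

theorem embIdeal_spanSingleton_mul (ξ : Fˣ) (M : Submodule (𝓞 F) B) :
    embIdeal B (FractionalIdeal.spanSingleton (𝓞 F)⁰ (ξ : F)) * M = rmul M (scalar B ξ) := by
  unfold embIdeal rmul
  rw [FractionalIdeal.coe_spanSingleton, Submodule.map_span, Set.image_singleton,
    Submodule.span_singleton_mul]
  ext b
  constructor
  · rintro ⟨a, ha, rfl⟩
    exact ⟨a, ha, (Algebra.commutes (ξ : F) a).symm⟩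
  · rintro ⟨a, ha, rfl⟩
    exact ⟨a, ha, Algebra.commutes (ξ : F) a⟩

theorem embIdeal_mul_rmul (𝔞 : FractionalIdeal (𝓞 F)⁰ F) (M : Submodule (𝓞 F) B) (x : Bˣ) :
    embIdeal B 𝔞 * rmul M x = rmul (embIdeal B 𝔞 * M) x := by
  have h : ∀ N : Submodule (𝓞 F) B, rmul N x = N * Submodule.span (𝓞 F) {(x : B)} := by
    intro N
    ext b
    exact Submodule.mem_mul_span_singleton.symm
  rw [h, h, mul_assoc]

/-- An invertible fractional ideal is locally generated by one element `ξ`. -/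
theorem exists_local_generator (𝔞 : (FractionalIdeal (𝓞 F)⁰ F)ˣ)
    (p : HeightOneSpectrum (𝓞 F)) :
    ∃ ξ : Fˣ, (ξ : F) ∈ (𝔞 : FractionalIdeal (𝓞 F)⁰ F) ∧ ∃ s : 𝓞 F, s ∉ p.asIdeal ∧
      ∀ a ∈ (𝔞 : FractionalIdeal (𝓞 F)⁰ F), ∃ c : 𝓞 F, s • a = c • (ξ : F) := by
  obtain ⟨α, hα, β, hβ, s, hs, hαβ⟩ : ∃ α ∈ (𝔞 : FractionalIdeal (𝓞 F)⁰ F),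
      ∃ β ∈ ((𝔞⁻¹ : (FractionalIdeal (𝓞 F)⁰ F)ˣ) : FractionalIdeal (𝓞 F)⁰ F),
      ∃ s : 𝓞 F, s ∉ p.asIdeal ∧ algebraMap (𝓞 F) F s = α * β := by
    by_contra! hcon
    have hle : ((𝔞 : FractionalIdeal (𝓞 F)⁰ F) : Submodule (𝓞 F) F) *
        (((𝔞⁻¹ : (FractionalIdeal (𝓞 F)⁰ F)ˣ) : FractionalIdeal (𝓞 F)⁰ F) : Submodule (𝓞 F) F) ≤
        IsLocalization.coeSubmodule F p.asIdeal := by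
      rw [Submodule.mul_le]
      intro α hα β hβ
      have h1 : α * β ∈ (1 : FractionalIdeal (𝓞 F)⁰ F) := by
        rw [← Units.mul_inv 𝔞]
        exact FractionalIdeal.mul_mem_mul hα hβ
      obtain ⟨s, hs⟩ := (FractionalIdeal.mem_one_iff _).1 h1
      by_cases hsp : s ∈ p.asIdeal
      · exact (IsLocalization.mem_coeSubmodule F _).2 ⟨s, hsp, hs⟩
      · exact absurd hs (hcon α hα β hβ s hsp)
    have h1 : (1 : F) ∈ IsLocalization.coeSubmodule F p.asIdeal := by
      apply hle
      rw [← FractionalIdeal.coe_mul, Units.mul_inv]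
      exact FractionalIdeal.one_mem_one _
    obtain ⟨s, hs, hs1⟩ := (IsLocalization.mem_coeSubmodule F _).1 h1
    have : s = 1 := FaithfulSMul.algebraMap_injective (𝓞 F) F (by simpa using hs1)
    exact p.isPrime.ne_top ((Ideal.eq_top_iff_one _).2 (this ▸ hs))
  have hs0 : s ≠ 0 := fun h => hs (h ▸ p.asIdeal.zero_mem)
  have hα0 : α ≠ 0 := by
    rintro rfl
    rw [zero_mul] at hαβ
    exact hs0 (FaithfulSMul.algebraMap_injective (𝓞 F) F (by simpa using hαβ))
  refine ⟨Units.mk0 α hα0, hα, s, hs, fun a ha => ?_⟩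
  have h1 : a * β ∈ (1 : FractionalIdeal (𝓞 F)⁰ F) := by
    rw [← Units.mul_inv 𝔞]
    exact FractionalIdeal.mul_mem_mul ha hβ
  obtain ⟨c, hc⟩ := (FractionalIdeal.mem_one_iff _).1 h1
  refine ⟨c, ?_⟩
  rw [Algebra.smul_def, Algebra.smul_def, hαβ, hc, Units.val_mk0]
  ring

/-- If `𝔞` is generated at `p` by `ξ`, then `(𝔞 M)_p = M_p ξ`. -/
theorem localAt_embIdeal_mul (𝔞 : (FractionalIdeal (𝓞 F)⁰ F)ˣ)
    (p : HeightOneSpectrum (𝓞 F)) : ∃ ξ : Fˣ, ∀ M : Submodule (𝓞 F) B,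
      localAt p (embIdeal B (𝔞 : FractionalIdeal (𝓞 F)⁰ F) * M) =
        rmul (localAt p M) (scalar B ξ) := by
  obtain ⟨ξ, hξ, s, hs, hgen⟩ := exists_local_generator 𝔞 p
  refine ⟨ξ, fun M => le_antisymm ?_ ?_⟩
  · have key : ∀ b ∈ embIdeal B (𝔞 : FractionalIdeal (𝓞 F)⁰ F) * M,
        s • b ∈ rmul M (scalar B ξ) := by
      intro b hb
      refine Submodule.mul_induction_on hb ?_ ?_
      · rintro _ ⟨a, ha, rfl⟩ n hn
        obtain ⟨c, hc⟩ := hgen a ha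
        rw [← smul_mul_assoc, ← LinearMap.map_smul, hc, LinearMap.map_smul, smul_mul_assoc]
        exact Submodule.smul_mem _ _ ⟨n, hn, (Algebra.commutes (ξ : F) n).symm⟩
      · intro a b ha hb
        rw [smul_add]
        exact Submodule.add_mem _ ha hb
    rintro b ⟨t, ht, hb⟩
    rw [← localAt_rmul]
    refine ⟨s * t, fun h => (p.isPrime.mem_or_mem h).elim hs ht, ?_⟩
    rw [mul_smul]
    exact key _ hb
  · rw [← localAt_rmul]
    rintro b ⟨t, ht, n, hn, hb⟩
    refine ⟨t, ht, ?_⟩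
    rw [← hb]
    have : (LinearMap.mulRight (𝓞 F) ((scalar B ξ : Bˣ) : B)) n = algebraMap F B ξ * n :=
      (Algebra.commutes (ξ : F) n).symm
    rw [this]
    exact Submodule.mul_mem_mul ⟨ξ, hξ, rfl⟩ hn

/-- The action `𝔞 I` of the fractional ideals of `F` on the invertible left ideals of `R`:
the `𝓞 F`-module generated by the products of elements of `𝔞` and of `I`. -/
def idealAct (𝔞 : (FractionalIdeal (𝓞 F)⁰ F)ˣ) (I : LeftIdeals R) : LeftIdeals R :=
  ⟨embIdeal B (𝔞 : FractionalIdeal (𝓞 F)⁰ F) * I.1, by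
    refine ⟨Submodule.FG.mul (Submodule.FG.map _ (FractionalIdeal.fg_unit 𝔞)) I.2.1, ?_, ?_⟩
    · intro r hr b hb
      refine Submodule.mul_induction_on hb ?_ ?_
      · rintro _ ⟨a, ha, rfl⟩ n hn
        have : r * (algebraMap F B a * n) = algebraMap F B a * (r * n) := by
          rw [← mul_assoc, ← Algebra.commutes, mul_assoc]
        change r * (algebraMap F B a * n) ∈ _
        rw [this]
        exact Submodule.mul_mem_mul ⟨a, ha, rfl⟩ (I.2.2.1 r hr n hn)
      · intro a b ha hb
        rw [mul_add]
        exact Submodule.add_mem _ ha hb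
    · intro p
      obtain ⟨ξ, hξ⟩ := localAt_embIdeal_mul (B := B) 𝔞 p
      obtain ⟨x, hx⟩ := I.2.2.2 p
      exact ⟨x * scalar B ξ, by rw [hξ, hx, rmul_rmul]⟩⟩

theorem idealAct_rmul (𝔞 : (FractionalIdeal (𝓞 F)⁰ F)ˣ) (I : LeftIdeals R) (x : Bˣ) :
    idealAct 𝔞 (I.rmul x) = (idealAct 𝔞 I).rmul x :=
  Subtype.ext (embIdeal_mul_rmul _ _ _)

/-- The map `[I] ↦ [𝔞 I]`. -/
def idealActCls (𝔞 : (FractionalIdeal (𝓞 F)⁰ F)ˣ) : IdealClasses R → IdealClasses R :=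
  Quotient.map' (s₁ := idealSetoid R) (s₂ := idealSetoid R) (idealAct 𝔞) (by
    rintro _ I ⟨x, rfl⟩
    exact ⟨x, idealAct_rmul 𝔞 I x⟩)

theorem idealActCls_mul (𝔞 𝔟 : (FractionalIdeal (𝓞 F)⁰ F)ˣ) (c : IdealClasses R) :
    idealActCls (𝔞 * 𝔟) c = idealActCls 𝔞 (idealActCls 𝔟 c) := by
  obtain ⟨I, rfl⟩ := Quotient.exists_rep c
  refine congrArg cls (Subtype.ext ?_)
  change embIdeal B ((𝔞 * 𝔟 : (FractionalIdeal (𝓞 F)⁰ F)ˣ) : FractionalIdeal (𝓞 F)⁰ F) * I.1 =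
    embIdeal B _ * (embIdeal B _ * I.1)
  rw [Units.val_mul, embIdeal_mul, mul_assoc]

theorem idealActCls_principal (ξ : Fˣ) (c : IdealClasses R) :
    idealActCls (toPrincipalIdeal (𝓞 F) F ξ) c = c := by
  obtain ⟨I, rfl⟩ := Quotient.exists_rep c
  refine Eq.trans (congrArg cls (Subtype.ext ?_)) (cls_rmul I (scalar B ξ))
  change embIdeal B ((toPrincipalIdeal (𝓞 F) F ξ : (FractionalIdeal (𝓞 F)⁰ F)ˣ) :
    FractionalIdeal (𝓞 F)⁰ F) * I.1 = _
  rw [coe_toPrincipalIdeal, embIdeal_spanSingleton_mul]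
  rfl

/-- The action of the class group of `F` on `Cl(R)`, with `[𝔞] [I] = [𝔞 I]`. -/
def classAct (a : ClassGroup (𝓞 F)) : IdealClasses R → IdealClasses R :=
  Quotient.lift (s := QuotientGroup.leftRel (toPrincipalIdeal (𝓞 F) F).range) idealActCls (by
    intro 𝔞 𝔟 h
    obtain ⟨ξ, hξ⟩ := QuotientGroup.leftRel_apply.1 h
    have h2 : 𝔟 = 𝔞 * toPrincipalIdeal (𝓞 F) F ξ := by rw [hξ]; group
    funext c
    rw [h2, idealActCls_mul, idealActCls_principal]) (ClassGroup.equiv F a)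

/-- The class `[𝔞]` of a fractional ideal acts by `[I] ↦ [𝔞 I]`. -/
theorem classAct_mk (𝔞 : (FractionalIdeal (𝓞 F)⁰ F)ˣ) (I : LeftIdeals R) :
    classAct (ClassGroup.mk F 𝔞) (cls I) = cls (idealAct 𝔞 I) := by
  have h : Units.mapEquiv (↑(FractionalIdeal.canonicalEquiv (𝓞 F)⁰ F F)) 𝔞 = 𝔞 := by
    ext1
    simp
  unfold classAct
  rw [ClassGroup.equiv_mk, h]
  rfl

/-- The action of the class group of `F` on `M(R)`: the linear extension of `classAct`. -/
def classOperator (R : Subalgebra (𝓞 F) B) (a : ClassGroup (𝓞 F)) : Forms R →ₗ[ℂ] Forms R :=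
  Finsupp.lmapDomain ℂ ℂ (classAct a)

end QuaternionicModular

end

/-! The heart of the matter is a duality: `J` lies in `t_m(I)` if and only if `m I` lies in `t_m(J)`
(`IsReducedNorm.mem_heckeSet_iff`). Granting it, `⟨T_m [I], [J]⟩` counts the classes of `x` with `J
x⁻¹ ∈ t_m(I)`, that is `J ∈ t_m(I x)`, that is `m I x ∈ t_m(J)`. These are the `x` with `I x = m⁻¹
K` for some `K ∈ t_m(J)`, which `⟨[I], [m⁻¹] T_m [J]⟩` counts
(`IsReducedNorm.sum_transporterCount`).

The duality is local. Let `I_p = R_p a`, `J_p = R_p b`, let `h = b a⁻¹` have reduced norm `n`, and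
let `ξ` generate `m` at `p`. The index is generated by `n ^ 2`
(`IsReducedNorm.mem_localAt_moduleIndex`), so `n` and `ξ` are associates, the local ring being
integrally closed. As `R_p` is closed under conjugation, `ξ h⁻¹ = (ξ / n) h̄` lies in `R_p`, which
gives `m I ⊆ J`; its norm `ξ ^ 2 / n` is again an associate of `ξ`.

All counts must be finite, since `Set.ncard` and `finsum` return 0 on infinite data. Total
definiteness makes the norm a totally positive form, which takes each value finitely often on a
lattice; the unit theorem then bounds transporters. The duality puts `J` between `m I` and `I`,
which bounds `t_m(I)`. Uniqueness holds because distinct classes are orthogonal and `⟨c, c⟩ ≠ 0`. -/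

namespace QuaternionicModular

/-! ### Lattices, localization and integrality -/

section Lattices

/-- An endomorphism of a vector space that preserves a finitely generated spanning `A`-submodule
has an integral determinant. -/
theorem isIntegral_det_of_map_le {A K V : Type*} [CommRing A] [Field K] [Algebra A K]
    [AddCommGroup V] [Module A V] [Module K V] [IsScalarTower A K V]
    {M : Submodule A V} (hM : M.FG) (hs : Submodule.span K (M : Set V) = ⊤)
    (δ : V →ₗ[K] V) (h : ∀ b ∈ M, δ b ∈ M) : IsIntegral A (LinearMap.det δ) := by
  have hfin : Module.Finite K V := by
    obtain ⟨s, hs'⟩ := hM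
    refine ⟨⟨s, ?_⟩⟩
    rw [eq_top_iff, ← hs, ← hs', Submodule.span_le]
    exact Submodule.span_subset_span A K _
  have : Module.Finite A M := Module.Finite.iff_fg.2 hM
  -- `M` need not be free, so there is no matrix over `A` to take the determinant of;
  -- Cayley–Hamilton for finite modules still gives a monic equation for `δ`.
  obtain ⟨p, hp, hp0⟩ := LinearMap.exists_monic_and_aeval_eq_zero A
    ((δ.restrictScalars A).restrict h)
  have hpow : ∀ (n : ℕ) (b : M),
      ((((δ.restrictScalars A).restrict h) ^ n) b : V) = (δ ^ n) (b : V) := by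
    intro n
    induction n with
    | zero => intro b; rfl
    | succ n ih => intro b; rw [pow_succ, pow_succ, Module.End.mul_apply, ih]; rfl
  have hδ : Polynomial.aeval δ (p.map (algebraMap A K)) = 0 := by
    have h1 : Submodule.span K (M : Set V) ≤
        LinearMap.ker (Polynomial.aeval δ (p.map (algebraMap A K))) := by
      rw [Submodule.span_le]
      intro b hb
      have h2 := congrArg (fun f => ((f ⟨b, hb⟩ : M) : V)) hp0
      rw [Polynomial.aeval_eq_sum_range] at h2
      simp only [LinearMap.sum_apply, LinearMap.smul_apply, LinearMap.zero_apply,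
        AddSubmonoidClass.coe_finsetSum, Submodule.coe_smul, hpow, ZeroMemClass.coe_zero] at h2
      rw [SetLike.mem_coe, LinearMap.mem_ker, Polynomial.aeval_map_algebraMap,
        Polynomial.aeval_eq_sum_range, LinearMap.sum_apply, ← h2]
      exact Finset.sum_congr rfl fun i _ => rfl
    rw [hs, top_le_iff, LinearMap.ker_eq_top] at h1
    exact h1
  classical
  let b := Module.finBasis K V
  -- Over an algebraic closure the determinant is the product of the eigenvalues, and each
  -- eigenvalue is a root of the monic `p`.
  let N := (LinearMap.toMatrix b b δ).map (algebraMap K (AlgebraicClosure K))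
  have hN : Polynomial.aeval N (p.map (algebraMap A (AlgebraicClosure K))) = 0 := by
    have h1 := Polynomial.aeval_algHom_apply ((Algebra.ofId K (AlgebraicClosure K)).mapMatrix.comp
      (LinearMap.toMatrixAlgEquiv b).toAlgHom) δ (p.map (algebraMap A K))
    rw [hδ, map_zero, Polynomial.aeval_map_algebraMap] at h1
    rw [Polynomial.aeval_map_algebraMap]
    exact h1
  have hdet : algebraMap K (AlgebraicClosure K) (LinearMap.det δ) = N.charpoly.roots.prod := by
    rw [← Matrix.det_eq_prod_roots_charpoly, ← LinearMap.det_toMatrix b, RingHom.map_det]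
    rfl
  rw [← isIntegral_algebraMap_iff (algebraMap K (AlgebraicClosure K)).injective, hdet]
  refine IsIntegral.multiset_prod fun μ hμ => ?_
  have hμ' : μ ∈ spectrum (AlgebraicClosure K) N :=
    Matrix.mem_spectrum_iff_isRoot_charpoly.2 (Polynomial.isRoot_of_mem_roots hμ)
  have h2 := spectrum.subset_polynomial_aeval N (p.map (algebraMap A (AlgebraicClosure K)))
    ⟨μ, hμ', rfl⟩
  rw [hN] at h2
  rcases subsingleton_or_nontrivial (Matrix (Fin (Module.finrank K V))
    (Fin (Module.finrank K V)) (AlgebraicClosure K)) with hss | hnt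
  · rw [spectrum.of_subsingleton] at hμ'
    exact hμ'.elim
  rw [spectrum.zero_eq, Set.mem_singleton_iff] at h2
  exact ⟨p, hp, by simpa [Polynomial.eval_map] using h2⟩

variable {F : Type*} [Field F] [NumberField F] {B : Type*} [Ring B] [Algebra F B]

theorem le_localAt (p : HeightOneSpectrum (𝓞 F)) (M : Submodule (𝓞 F) B) : M ≤ localAt p M :=
  fun b hb => ⟨1, fun h => p.isPrime.ne_top ((Ideal.eq_top_iff_one _).2 h), by simpa using hb⟩

theorem localAt_mono (p : HeightOneSpectrum (𝓞 F)) {M N : Submodule (𝓞 F) B} (h : M ≤ N) :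
    localAt p M ≤ localAt p N :=
  fun _ ⟨s, hs, hb⟩ => ⟨s, hs, h hb⟩

theorem mem_localAt_of_smul_mem {p : HeightOneSpectrum (𝓞 F)} {M : Submodule (𝓞 F) B}
    {s : 𝓞 F} (hs : s ∉ p.asIdeal) {b : B} (h : s • b ∈ localAt p M) : b ∈ localAt p M := by
  obtain ⟨t, ht, hb⟩ := h
  exact ⟨t * s, fun h => (p.isPrime.mem_or_mem h).elim ht hs, by rwa [mul_smul]⟩

/-- The ideal of all `r` with `r • b ∈ N` lies in no maximal ideal, so it contains 1. -/
theorem le_of_forall_localAt_le {M N : Submodule (𝓞 F) B}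
    (h : ∀ p : HeightOneSpectrum (𝓞 F), localAt p M ≤ localAt p N) : M ≤ N := by
  intro b hb
  let I : Ideal (𝓞 F) := N.comap (LinearMap.toSpanSingleton (𝓞 F) B b)
  have hI : I = ⊤ := by
    by_contra hne
    obtain ⟨P, hP, hIP⟩ := Ideal.exists_le_maximal I hne
    obtain ⟨s, hs, hsb⟩ := h ⟨P, hP.isPrime,
      Ring.ne_bot_of_isMaximal_of_not_isField hP (RingOfIntegers.not_isField F)⟩
      (le_localAt _ _ hb)
    exact hs (hIP hsb)
  have h1 : (1 : 𝓞 F) ∈ I := hI ▸ Submodule.mem_top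
  simpa [I] using h1

/-- A finitely generated submodule of a localization is moved into the original module by one
denominator. -/
theorem exists_smul_mem_of_le_localAt {p : HeightOneSpectrum (𝓞 F)} {C : Type*} [AddCommGroup C]
    [Module (𝓞 F) C] {M : Submodule (𝓞 F) C} {N : Submodule (𝓞 F) B} (hM : M.FG)
    (f : C →ₗ[𝓞 F] B) (h : ∀ c ∈ M, f c ∈ localAt p N) :
    ∃ s : 𝓞 F, s ∉ p.asIdeal ∧ ∀ c ∈ M, s • f c ∈ N := by
  induction M, hM using Submodule.fg_induction with
  | singleton x =>
    obtain ⟨s, hs, hx⟩ := h x (Submodule.mem_span_singleton_self x)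
    refine ⟨s, hs, fun c hc => ?_⟩
    obtain ⟨r, rfl⟩ := Submodule.mem_span_singleton.1 hc
    rw [map_smul, smul_comm]
    exact N.smul_mem _ hx
  | sup M₁ M₂ _ _ h₁ h₂ =>
    obtain ⟨s, hs, hs'⟩ := h₁ fun c hc => h c (Submodule.mem_sup_left hc)
    obtain ⟨t, ht, ht'⟩ := h₂ fun c hc => h c (Submodule.mem_sup_right hc)
    refine ⟨s * t, fun h => (p.isPrime.mem_or_mem h).elim hs ht, fun c hc => ?_⟩
    obtain ⟨a, ha, b, hb, rfl⟩ := Submodule.mem_sup.1 hc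
    rw [map_add, smul_add]
    refine N.add_mem ?_ ?_
    · rw [mul_comm, mul_smul]; exact N.smul_mem _ (hs' a ha)
    · rw [mul_smul]; exact N.smul_mem _ (ht' b hb)

theorem mem_localAt_one {p : HeightOneSpectrum (𝓞 F)} {x : F} :
    x ∈ localAt p (1 : Submodule (𝓞 F) F) ↔
      ∃ s : 𝓞 F, s ∉ p.asIdeal ∧ IsIntegral (𝓞 F) (s • x) := by
  refine exists_congr fun s => and_congr_right fun _ => ?_
  rw [IsIntegrallyClosed.isIntegral_iff, Submodule.mem_one]

theorem isIntegral_mem_localAt_one (p : HeightOneSpectrum (𝓞 F)) {x : F}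
    (h : IsIntegral (𝓞 F) x) : x ∈ localAt p (1 : Submodule (𝓞 F) F) :=
  mem_localAt_one.2 ⟨1, fun h => p.isPrime.ne_top ((Ideal.eq_top_iff_one _).2 h), by simpa using h⟩

theorem localAt_one_mul_mem {p : HeightOneSpectrum (𝓞 F)} {x y : F}
    (hx : x ∈ localAt p (1 : Submodule (𝓞 F) F)) (hy : y ∈ localAt p (1 : Submodule (𝓞 F) F)) :
    x * y ∈ localAt p (1 : Submodule (𝓞 F) F) := by
  obtain ⟨s, hs, hsx⟩ := mem_localAt_one.1 hx
  obtain ⟨t, ht, hty⟩ := mem_localAt_one.1 hy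
  refine mem_localAt_one.2 ⟨s * t, fun h => (p.isPrime.mem_or_mem h).elim hs ht, ?_⟩
  rw [mul_smul_mul_comm]
  exact hsx.mul hty

/-- The local ring is integrally closed. Determinants only show squares of reduced norms, and this
removes the square. -/
theorem mem_localAt_one_of_pow {p : HeightOneSpectrum (𝓞 F)} {x : F} {n : ℕ} (hn : n ≠ 0)
    (hx : x ^ n ∈ localAt p (1 : Submodule (𝓞 F) F)) :
    x ∈ localAt p (1 : Submodule (𝓞 F) F) := by
  obtain ⟨s, hs, h⟩ := mem_localAt_one.1 hx
  refine mem_localAt_one.2 ⟨s, hs, IsIntegral.of_pow (Nat.pos_of_ne_zero hn) ?_⟩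
  obtain ⟨k, rfl⟩ := Nat.exists_eq_succ_of_ne_zero hn
  rw [smul_pow, pow_succ s, mul_smul]
  exact h.smul _

/-- Elements of the local ring act on the localizations. -/
theorem smul_mem_localAt {p : HeightOneSpectrum (𝓞 F)} {M : Submodule (𝓞 F) B} {x : F}
    (hx : x ∈ localAt p (1 : Submodule (𝓞 F) F)) {b : B} (hb : b ∈ localAt p M) :
    x • b ∈ localAt p M := by
  obtain ⟨s, hs, h⟩ := hx
  obtain ⟨r, hr⟩ := Submodule.mem_one.1 h
  refine mem_localAt_of_smul_mem hs ?_
  rw [← smul_assoc, ← hr, algebraMap_smul]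
  exact Submodule.smul_mem _ _ hb

end Lattices

/-! ### The reduced norm and its definiteness -/

section ReducedNorm

section Norm

variable {F : Type*} [Field F] {B : Type*} [Ring B] [Algebra F B]

/-- The identities that the reduced norm `N` of a quaternion algebra satisfies: `N (1 + x) - N x - 1`
is the reduced trace of `x`, and subtracting `x` from it gives the conjugate of `x`. -/
structure IsReducedNorm (N : B →* F) : Prop where
  mul_conj : ∀ x, x * (algebraMap F B (N (1 + x) - N x - 1) - x) = algebraMap F B (N x)
  det_mulRight : ∀ x, LinearMap.det (LinearMap.mulRight F x) = N x ^ 2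
  map_algebraMap : ∀ c : F, N (algebraMap F B c) = c ^ 2

/-- The norm `q * star q` of a quaternion. -/
def quaternionNorm (a b : F) : ℍ[F, a, b] →* F where
  toFun q := q.re ^ 2 - a * q.imI ^ 2 - b * q.imJ ^ 2 + a * b * q.imK ^ 2
  map_one' := by simp
  map_mul' p q := by simp; ring

theorem quaternionNorm_apply (a b : F) (q : ℍ[F, a, b]) :
    quaternionNorm a b q = q.re ^ 2 - a * q.imI ^ 2 - b * q.imJ ^ 2 + a * b * q.imK ^ 2 :=
  rfl

theorem isReducedNorm_quaternionNorm (a b : F) : IsReducedNorm (quaternionNorm a b) where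
  mul_conj x := by
    have h : quaternionNorm a b (1 + x) - quaternionNorm a b x - 1 = 2 * x.re := by
      simp only [quaternionNorm_apply]
      simp
      ring
    rw [h, Algebra.algebraMap_eq_smul_one, Algebra.algebraMap_eq_smul_one, quaternionNorm_apply]
    ext <;> simp <;> ring
  det_mulRight x := by
    -- The argument 0 is the coefficient of `i` in `i * i = a + 0 * i`.
    have h : LinearMap.toMatrix (QuaternionAlgebra.basisOneIJK a 0 b)
        (QuaternionAlgebra.basisOneIJK a 0 b) (LinearMap.mulRight F x) =
        !![x.re, a * x.imI, b * x.imJ, -(a * b * x.imK);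
          x.imI, x.re, -(b * x.imK), b * x.imJ;
          x.imJ, a * x.imK, x.re, -(a * x.imI);
          x.imK, x.imJ, -x.imI, x.re] := by
      have hv : ∀ j, QuaternionAlgebra.basisOneIJK a 0 b j =
          ![⟨1, 0, 0, 0⟩, ⟨0, 1, 0, 0⟩, ⟨0, 0, 1, 0⟩, ⟨0, 0, 0, 1⟩] j := by
        intro j
        apply (QuaternionAlgebra.basisOneIJK a 0 b).repr.injective
        rw [Module.Basis.repr_self]
        ext i
        rw [QuaternionAlgebra.coe_basisOneIJK_repr]
        fin_cases i <;> fin_cases j <;> simp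
      ext i j
      rw [LinearMap.toMatrix_apply, QuaternionAlgebra.coe_basisOneIJK_repr, hv]
      fin_cases i <;> fin_cases j <;> simp
    rw [← LinearMap.det_toMatrix (QuaternionAlgebra.basisOneIJK a 0 b), h, quaternionNorm_apply]
    simp [Matrix.det_succ_row_zero, Fin.sum_univ_succ, Fin.succAbove]
    ring
  map_algebraMap c := by
    rw [Algebra.algebraMap_eq_smul_one, quaternionNorm_apply]
    simp

theorem IsReducedNorm.comp_algEquiv {C : Type*} [Ring C] [Algebra F C] {N : B →* F}
    (hN : IsReducedNorm N) (e : C ≃ₐ[F] B) : IsReducedNorm (N.comp (e : C →* B)) where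
  mul_conj x := by
    apply e.injective
    simpa using hN.mul_conj (e x)
  det_mulRight x := by
    have h : LinearMap.mulRight F x = (e.symm.toLinearEquiv : B →ₗ[F] C) ∘ₗ
        LinearMap.mulRight F (e x) ∘ₗ (e.symm.toLinearEquiv.symm : C →ₗ[F] B) := by
      ext y
      simp
    rw [h, LinearMap.det_conj, hN.det_mulRight]
    rfl
  map_algebraMap c := by simpa using hN.map_algebraMap c

/-- In an algebra that is ramified at every real place, the square of an element that is not a
scalar is negative as soon as it is a scalar. -/
theorem IsTotallyDefinite.map_neg (hdef : IsTotallyDefinite F B) {i : B} {a : F}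
    (hi : i * i = algebraMap F B a) (f : B →ₗ[F] F) (hf : f 1 = 0) (hfi : f i = 1)
    (τ : F →+* ℝ) : τ a < 0 := by
  by_contra! hτ
  let : Algebra F ℝ := τ.toAlgebra
  -- The scalar extension of `f` kills `r ⊗ 1` and takes the value 1 on `1 ⊗ i`.
  have hne : ∀ r : ℝ, (r ⊗ₜ[F] (1 : B) + (1 : ℝ) ⊗ₜ[F] i) ≠ 0 := by
    intro r h
    have h1 := congrArg (fun z => TensorProduct.rid F ℝ (f.lTensor ℝ z)) h
    simp [hf, hfi] at h1
  -- If `τ a ≥ 0`, then `i ^ 2 - a` factors over `ℝ` and produces zero divisors.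
  have hmul : ((√(τ a)) ⊗ₜ[F] (1 : B) + (1 : ℝ) ⊗ₜ[F] i) *
      ((-√(τ a)) ⊗ₜ[F] (1 : B) + (1 : ℝ) ⊗ₜ[F] i) = 0 := by
    have h1 : (1 : ℝ) ⊗ₜ[F] algebraMap F B a = (τ a) ⊗ₜ[F] (1 : B) := by
      rw [Algebra.algebraMap_eq_smul_one, ← TensorProduct.smul_tmul, Algebra.smul_def, mul_one]
      rfl
    simp only [add_mul, mul_add, Algebra.TensorProduct.tmul_mul_tmul, mul_one, one_mul, hi, h1,
      mul_neg, Real.mul_self_sqrt hτ, TensorProduct.neg_tmul]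
    abel
  exact hne _ ((hdef τ _ (hne _)).mul_right_eq_zero.1 hmul)

end Norm

variable {F : Type*} [Field F] [NumberField F] {B : Type*} [Ring B] [Algebra F B]

theorem exists_smul_isIntegral {M : Submodule (𝓞 F) B} (hM : M.FG) (f : B →ₗ[F] F) :
    ∃ d : 𝓞 F, d ≠ 0 ∧ ∀ y ∈ M, IsIntegral (𝓞 F) (d • f y) := by
  induction M, hM using Submodule.fg_induction with
  | singleton x =>
    obtain ⟨⟨d, hd⟩, hx⟩ := IsLocalization.exists_integer_multiple (𝓞 F)⁰ (f x)
    refine ⟨d, nonZeroDivisors.ne_zero hd, fun c hc => ?_⟩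
    obtain ⟨r, rfl⟩ := Submodule.mem_span_singleton.1 hc
    obtain ⟨y, hy⟩ := hx
    rw [← algebraMap_smul F r x, map_smul, algebraMap_smul, smul_comm]
    exact IsIntegral.smul _ (hy ▸ isIntegral_algebraMap)
  | sup M₁ M₂ _ _ h₁ h₂ =>
    obtain ⟨s, hs, hs'⟩ := h₁
    obtain ⟨t, ht, ht'⟩ := h₂
    refine ⟨s * t, mul_ne_zero hs ht, fun c hc => ?_⟩
    obtain ⟨a, ha, b, hb, rfl⟩ := Submodule.mem_sup.1 hc
    rw [map_add, smul_add]
    refine IsIntegral.add ?_ ?_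
    · rw [mul_comm, mul_smul]; exact (hs' a ha).smul _
    · rw [mul_smul]; exact (ht' b hb).smul _

/-- A totally positive diagonal quadratic form takes each value finitely often on a finitely
generated module. -/
theorem finite_setOf_sum_sq_eq [IsTotallyReal F] {ι : Type*} [Fintype ι]
    (f : ι → B →ₗ[F] F) (hf : ∀ x y, (∀ i, f i x = f i y) → x = y) (w : ι → F)
    (hw : ∀ (τ : F →+* ℝ) i, 0 < τ (w i)) {M : Submodule (𝓞 F) B} (hM : M.FG) (c : F) :
    {y | y ∈ M ∧ ∑ i, w i * f i y ^ 2 = c}.Finite := by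
  choose d hd hdf using fun i => exists_smul_isIntegral hM (f i)
  -- By positivity each term `w i * f i y ^ 2` is at most `c` in every real embedding, so `d ^ 2 * c
  -- / w` bounds the square of the integral coordinate `d i • f i y`. There are finitely many
  -- algebraic integers of `F` with all conjugates bounded.
  obtain ⟨C, hC⟩ : ∃ C : ℝ, ∀ (φ : F →+* ℂ) i, ‖φ (d i ^ 2 * (c / w i))‖ ≤ C := by
    obtain ⟨C, hC⟩ := (Set.finite_range fun q : (F →+* ℂ) × ι =>
      ‖q.1 (d q.2 ^ 2 * (c / w q.2))‖).bddAbove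
    exact ⟨C, fun φ i => hC ⟨(φ, i), rfl⟩⟩
  have hfin := Embeddings.finite_of_norm_le F ℂ (√C)
  refine Set.Finite.of_finite_image (f := fun y i => d i • f i y)
    ((Set.Finite.pi fun _ : ι => hfin).subset ?_) ?_
  · rintro _ ⟨y, ⟨hyM, hy⟩, rfl⟩ i -
    refine ⟨isIntegral_trans _ (hdf i y hyM), fun φ => ?_⟩
    have hφ : ComplexEmbedding.IsReal φ := InfinitePlace.isReal_mk_iff.1 (IsTotallyReal.isReal _)
    have hnorm : ∀ x, ‖φ x‖ = |hφ.embedding x| := fun x => by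
      rw [← hφ.coe_embedding_apply, Complex.norm_real, Real.norm_eq_abs]
    refine Real.le_sqrt_of_sq_le (le_trans ?_ (hC φ i))
    set τ := hφ.embedding
    have hwi := hw τ i
    have h1 : τ (w i * f i y ^ 2) ≤ τ c := by
      rw [← hy, map_sum]
      refine Finset.single_le_sum (f := fun i => τ (w i * f i y ^ 2)) (fun j _ => ?_)
        (Finset.mem_univ i)
      rw [map_mul, map_pow]
      exact mul_nonneg (hw τ j).le (sq_nonneg _)
    change ‖φ (d i • f i y)‖ ^ 2 ≤ _
    rw [hnorm, hnorm, sq_abs, Algebra.smul_def, map_mul, map_mul, mul_pow, map_pow, map_div₀]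
    refine le_trans (mul_le_mul_of_nonneg_left ?_ (sq_nonneg _)) (le_abs_self _)
    rw [le_div_iff₀ hwi]
    rwa [map_mul, map_pow, mul_comm] at h1
  · intro x _ y _ hxy
    refine hf x y fun i => ?_
    have := congrFun hxy i
    exact smul_right_injective F (hd i) this

/-- The elements `i` and `j` are not scalars but have squares `a` and `b`, so definiteness makes `a`
and `b` totally negative. The coefficients `1, -a, -b, ab` of the norm form are then totally
positive. -/
theorem exists_isReducedNorm [IsTotallyReal F] (hB : IsQuaternionAlgebra F B)
    (hdef : IsTotallyDefinite F B) : ∃ N : B →* F, IsReducedNorm N ∧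
      ∀ M : Submodule (𝓞 F) B, M.FG → ∀ c, {y | y ∈ M ∧ N y = c}.Finite := by
  obtain ⟨a, b, -, -, ⟨e⟩⟩ := hB
  refine ⟨_, (isReducedNorm_quaternionNorm a b).comp_algEquiv e.symm, fun M hM c => ?_⟩
  let g : Fin 4 → B →ₗ[F] F := fun i =>
    (QuaternionAlgebra.basisOneIJK a 0 b).coord i ∘ₗ (e.symm.toLinearEquiv : B →ₗ[F] ℍ[F, a, b])
  have ha : ∀ τ : F →+* ℝ, τ a < 0 := hdef.map_neg (i := e ⟨0, 1, 0, 0⟩)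
    (by rw [← map_mul, ← e.commutes]; congr 1; ext <;> simp)
    (g 1) (by simp [g]) (by simp [g])
  have hb : ∀ τ : F →+* ℝ, τ b < 0 := hdef.map_neg (i := e ⟨0, 0, 1, 0⟩)
    (by rw [← map_mul, ← e.commutes]; congr 1; ext <;> simp)
    (g 2) (by simp [g]) (by simp [g])
  have := finite_setOf_sum_sq_eq g (fun x y h => ?_) ![1, -a, -b, a * b] (fun τ i => ?_) hM c
  · convert this using 5 with y
    simp [g, Fin.sum_univ_succ, quaternionNorm_apply]
    ring
  · apply e.symm.injective
    apply (QuaternionAlgebra.basisOneIJK a 0 b).repr.injective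
    ext i
    exact h i
  · fin_cases i
    · simp
    · simpa using ha τ
    · simpa using hb τ
    · simpa using mul_pos_of_neg_of_neg (ha τ) (hb τ)

end ReducedNorm

/-! ### Orders at a prime and the local index -/

section LocalIndex

variable {F : Type*} [Field F] [NumberField F] {B : Type*} [Ring B] [Algebra F B]

/-- Finite generation passes to submodules because `𝓞 F` is Noetherian. The intersection spans
because every element of `S₁` has a nonzero integral multiple in `S₂`. -/
theorem IsEichlerOrder.isOrder {R : Subalgebra (𝓞 F) B} (hR : IsEichlerOrder R) : IsOrder R := by
  obtain ⟨S₁, S₂, h₁, h₂, rfl⟩ := hR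
  have hS₁ := h₁.prop
  have hS₂ := h₂.prop
  refine ⟨hS₁.1.of_le (fun x hx => hx.1), ?_⟩
  have key : ∀ b : B, ∃ d : 𝓞 F, d ≠ 0 ∧ d • b ∈ S₂ := by
    intro b
    have hb : b ∈ Submodule.span F (S₂ : Set B) := hS₂.2 ▸ Submodule.mem_top
    induction hb using Submodule.span_induction with
    | mem x hx => exact ⟨1, one_ne_zero, by simpa using hx⟩
    | zero => exact ⟨1, one_ne_zero, by simp⟩
    | add x y _ _ hx hy =>
      obtain ⟨s, hs, hsx⟩ := hx
      obtain ⟨t, ht, hty⟩ := hy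
      refine ⟨s * t, mul_ne_zero hs ht, ?_⟩
      rw [smul_add]
      refine S₂.add_mem ?_ ?_
      · rw [mul_comm, mul_smul]; exact S₂.smul_mem hsx t
      · rw [mul_smul]; exact S₂.smul_mem hty s
    | smul c x _ hx =>
      obtain ⟨s, hs, hsx⟩ := hx
      obtain ⟨⟨d, hd⟩, e, he⟩ := IsLocalization.exists_integer_multiple (𝓞 F)⁰ c
      refine ⟨d * s, mul_ne_zero (nonZeroDivisors.ne_zero hd) hs, ?_⟩
      have h : (d * s) • c • x = e • s • x := by
        rw [mul_smul, smul_comm s c x, ← smul_assoc, ← algebraMap_smul F e, he]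
      rw [h]
      exact S₂.smul_mem hsx e
  rw [eq_top_iff, ← hS₁.2, Submodule.span_le]
  intro r hr
  obtain ⟨d, hd, h⟩ := key r
  have hd' : (algebraMap (𝓞 F) F d) ≠ 0 := by simpa using hd
  have h1 : r = (algebraMap (𝓞 F) F d)⁻¹ • (d • r) := by
    rw [← algebraMap_smul F d r, inv_smul_smul₀ hd']
  rw [h1]
  exact Submodule.smul_mem _ _ (Submodule.subset_span ⟨S₁.smul_mem hr d, h⟩)

theorem scalar_mul_comm (ξ : Fˣ) (x : Bˣ) : scalar B ξ * x = x * scalar B ξ :=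
  Units.ext (Algebra.commutes (ξ : F) (x : B))

section Local

variable {R : Subalgebra (𝓞 F) B} {p : HeightOneSpectrum (𝓞 F)}

theorem one_mem_localAt : (1 : B) ∈ localAt p R.toSubmodule :=
  le_localAt p _ R.one_mem

theorem mul_mem_localAt {x y : B} (hx : x ∈ localAt p R.toSubmodule)
    (hy : y ∈ localAt p R.toSubmodule) : x * y ∈ localAt p R.toSubmodule := by
  obtain ⟨s, hs, hsx⟩ := hx
  obtain ⟨t, ht, hty⟩ := hy
  refine ⟨s * t, fun h => (p.isPrime.mem_or_mem h).elim hs ht, ?_⟩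
  rw [← smul_mul_smul_comm]
  exact R.mul_mem hsx hty

/-- One denominator `s` outside `p` makes `s • δ` preserve `R`. This multiplies the determinant by a
power of `s`, which is still outside `p`. -/
theorem IsOrder.det_mem_localAt (hR : IsOrder R) {δ : B →ₗ[F] B}
    (h : ∀ r ∈ R, δ r ∈ localAt p R.toSubmodule) :
    LinearMap.det δ ∈ localAt p (1 : Submodule (𝓞 F) F) := by
  obtain ⟨s, hs, hsδ⟩ := exists_smul_mem_of_le_localAt hR.1 (δ.restrictScalars (𝓞 F)) h
  have h1 := isIntegral_det_of_map_le hR.1 hR.2 (algebraMap (𝓞 F) F s • δ) fun r hr => by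
    rw [LinearMap.smul_apply, algebraMap_smul]
    exact hsδ r hr
  rw [LinearMap.det_smul, ← map_pow, ← Algebra.smul_def] at h1
  exact mem_localAt_one.2 ⟨_, fun h => hs (p.isPrime.mem_of_pow_mem _ h), h1⟩

variable {N : B →* F}

/-- Right multiplication by `x` preserves `R_p` and has determinant `N x ^ 2`. -/
theorem IsReducedNorm.mem_localAt (hN : IsReducedNorm N) (hR : IsOrder R) {x : B}
    (hx : x ∈ localAt p R.toSubmodule) : N x ∈ localAt p (1 : Submodule (𝓞 F) F) := by
  refine mem_localAt_one_of_pow two_ne_zero ?_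
  rw [← hN.det_mulRight]
  exact hR.det_mem_localAt fun r hr => mul_mem_localAt (le_localAt p _ hr) hx

/-- The localization of an order is closed under conjugation. -/
theorem IsReducedNorm.conj_mem_localAt (hN : IsReducedNorm N) (hR : IsOrder R) {x : B}
    (hx : x ∈ localAt p R.toSubmodule) :
    algebraMap F B (N (1 + x) - N x - 1) - x ∈ localAt p R.toSubmodule := by
  refine Submodule.sub_mem _ ?_ hx
  rw [Algebra.algebraMap_eq_smul_one]
  refine smul_mem_localAt ?_ one_mem_localAt
  refine Submodule.sub_mem _ (Submodule.sub_mem _ ?_ (hN.mem_localAt hR hx)) ?_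
  · exact hN.mem_localAt hR (Submodule.add_mem _ one_mem_localAt hx)
  · exact isIntegral_mem_localAt_one p isIntegral_one

theorem IsReducedNorm.map_units_mul_inv (N : B →* F) (x : Bˣ) : N x * N ((x⁻¹ : Bˣ) : B) = 1 := by
  rw [← map_mul, Units.mul_inv, map_one]

/-- At a prime where `I = R a` and `J = R b`, the index `[I : J]` is generated by the square of the
norm of `a⁻¹ b`. -/
theorem IsReducedNorm.mem_localAt_moduleIndex (hN : IsReducedNorm N) (hR : IsOrder R)
    {I J : Submodule (𝓞 F) B} (hI : I.FG) {a b : Bˣ}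
    (ha : localAt p I = rmul (localAt p R.toSubmodule) a)
    (hb : localAt p J = rmul (localAt p R.toSubmodule) b) {c : F} :
    c ∈ localAt p (moduleIndex I J) ↔
      c * N ((a * b⁻¹ : Bˣ) : B) ^ 2 ∈ localAt p (1 : Submodule (𝓞 F) F) := by
  constructor
  · have key : ∀ d ∈ moduleIndex I J,
        d * N ((a * b⁻¹ : Bˣ) : B) ^ 2 ∈ localAt p (1 : Submodule (𝓞 F) F) := by
      intro d hd
      induction hd using Submodule.span_induction with
      | mem d hd =>
        obtain ⟨δ, hδ, rfl⟩ := hd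
        -- Right multiplications by `a` and `b⁻¹` turn a map from `I` to `J` into one that preserves
        -- `R_p`.
        have h1 : LinearMap.det (LinearMap.mulRight F ((b⁻¹ : Bˣ) : B) ∘ₗ δ ∘ₗ
            LinearMap.mulRight F (a : B)) ∈ localAt p (1 : Submodule (𝓞 F) F) := by
          refine hR.det_mem_localAt fun r hr => ?_
          have h2 : r * a ∈ localAt p I := by
            rw [ha, mem_rmul]
            simpa using le_localAt p _ hr
          have h3 : δ (r * a) ∈ localAt p J := by
            obtain ⟨s, hs, h⟩ := h2
            refine ⟨s, hs, ?_⟩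
            have := hδ _ h
            rwa [← algebraMap_smul F s (r * (a : B)), map_smul, algebraMap_smul] at this
          rw [hb, mem_rmul] at h3
          exact h3
        rw [LinearMap.det_comp, LinearMap.det_comp, hN.det_mulRight, hN.det_mulRight] at h1
        rw [Units.val_mul, map_mul]
        convert h1 using 1
        ring
      | zero => rw [zero_mul]; exact Submodule.zero_mem _
      | add x y _ _ hx hy => rw [add_mul]; exact Submodule.add_mem _ hx hy
      | smul r x _ hx => rw [smul_mul_assoc]; exact Submodule.smul_mem _ r hx
    rintro ⟨s, hs, h⟩
    refine mem_localAt_of_smul_mem hs ?_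
    rw [← smul_mul_assoc]
    exact key _ h
  · intro hc
    -- Right multiplication by `a⁻¹ b` maps `I_p` onto `J_p`, so up to a denominator its determinant
    -- supplies the generator of the index.
    have h1 : ∀ x ∈ I, x * ((a⁻¹ * b : Bˣ) : B) ∈ localAt p J := by
      intro x hx
      have h2 := le_localAt p _ hx
      rw [ha, mem_rmul] at h2
      rw [hb, mem_rmul]
      simpa [mul_assoc] using h2
    obtain ⟨s, hs, hsx⟩ := exists_smul_mem_of_le_localAt hI
      (LinearMap.mulRight (𝓞 F) ((a⁻¹ * b : Bˣ) : B)) h1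
    have h2 : LinearMap.det (algebraMap (𝓞 F) F s •
        LinearMap.mulRight F ((a⁻¹ * b : Bˣ) : B)) ∈ moduleIndex I J := by
      refine Submodule.subset_span ⟨_, fun x hx => ?_, rfl⟩
      rw [LinearMap.smul_apply, algebraMap_smul]
      exact hsx x hx
    rw [LinearMap.det_smul, hN.det_mulRight, ← map_pow, ← Algebra.smul_def] at h2
    have h3 : N ((a⁻¹ * b : Bˣ) : B) ^ 2 ∈ localAt p (moduleIndex I J) :=
      ⟨_, fun h => hs (p.isPrime.mem_of_pow_mem _ h), h2⟩
    have h4 := smul_mem_localAt hc h3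
    have h5 : N ((a * b⁻¹ : Bˣ) : B) * N ((a⁻¹ * b : Bˣ) : B) = 1 := by
      rw [Units.val_mul, Units.val_mul, map_mul, map_mul, mul_mul_mul_comm,
        IsReducedNorm.map_units_mul_inv, one_mul, mul_comm, IsReducedNorm.map_units_mul_inv]
    rwa [smul_eq_mul, mul_assoc, ← mul_pow, h5, one_pow, mul_one] at h4

variable (B) in
-- The same `ξ` must serve in `B` and in `F`. The statement in `F` is read off from the one in `B`,
-- applied twice to the image of `𝓞 F`, since `F` embeds in `B`.
theorem exists_local_generator_sq [Nontrivial B] (𝔞 : (FractionalIdeal (𝓞 F)⁰ F)ˣ)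
    (p : HeightOneSpectrum (𝓞 F)) : ∃ ξ : Fˣ,
      (∀ M : Submodule (𝓞 F) B, localAt p (embIdeal B (𝔞 : FractionalIdeal (𝓞 F)⁰ F) * M) =
        rmul (localAt p M) (scalar B ξ)) ∧
      ∀ c : F, c ∈ localAt p ((𝔞 * 𝔞 : FractionalIdeal (𝓞 F)⁰ F) : Submodule (𝓞 F) F) ↔
        c * ((ξ : F)⁻¹) ^ 2 ∈ localAt p (1 : Submodule (𝓞 F) F) := by
  obtain ⟨ξ, hξ⟩ := localAt_embIdeal_mul (B := B) 𝔞 p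
  refine ⟨ξ, hξ, fun c => ?_⟩
  have hmap : ∀ (M : Submodule (𝓞 F) F) (c : F), c ∈ localAt p M ↔
      algebraMap F B c ∈
        localAt p (M.map (IsScalarTower.toAlgHom (𝓞 F) F B).toLinearMap) := by
    intro M c
    refine exists_congr fun s => and_congr_right fun _ => ?_
    have h : s • algebraMap F B c = (IsScalarTower.toAlgHom (𝓞 F) F B).toLinearMap (s • c) := by
      rw [map_smul]; rfl
    rw [h]
    constructor
    · exact fun hc => ⟨_, hc, rfl⟩
    · rintro ⟨d, hd, hdc⟩
      rwa [← FaithfulSMul.algebraMap_injective F B hdc]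
  have h1 : localAt p (((𝔞 * 𝔞 : FractionalIdeal (𝓞 F)⁰ F) : Submodule (𝓞 F) F).map
      (IsScalarTower.toAlgHom (𝓞 F) F B).toLinearMap) =
      rmul (rmul (localAt p 1) (scalar B ξ)) (scalar B ξ) := by
    change localAt p (embIdeal B _) = _
    rw [embIdeal_mul, ← mul_one (embIdeal B _ * embIdeal B _), mul_assoc, hξ, hξ]
  rw [hmap, h1, rmul_rmul, mem_rmul, hmap 1, Submodule.map_one]
  have h2 : ((((scalar B ξ * scalar B ξ)⁻¹ : Bˣ)) : B) = algebraMap F B ((ξ : F)⁻¹ ^ 2) := by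
    rw [show scalar B ξ * scalar B ξ = scalar B (ξ * ξ) from (map_mul _ _ _).symm]
    change algebraMap F B (((ξ * ξ)⁻¹ : Fˣ) : F) = _
    rw [Units.val_inv_eq_inv_val, Units.val_mul, ← pow_two, inv_pow]
  rw [h2, map_mul]

end Local

/-! ### The duality between `J ∈ t_m(I)` and `m I ∈ t_m(J)` -/

section Ideals

variable {R : Subalgebra (𝓞 F) B}

theorem idealAct_mul (𝔞 𝔟 : (FractionalIdeal (𝓞 F)⁰ F)ˣ) (I : LeftIdeals R) :
    idealAct (𝔞 * 𝔟) I = idealAct 𝔞 (idealAct 𝔟 I) := by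
  refine Subtype.ext ?_
  change embIdeal B ((𝔞 * 𝔟 : (FractionalIdeal (𝓞 F)⁰ F)ˣ) : FractionalIdeal (𝓞 F)⁰ F) * I.1 =
    embIdeal B _ * (embIdeal B _ * I.1)
  rw [Units.val_mul, embIdeal_mul, mul_assoc]

theorem idealAct_one (I : LeftIdeals R) :
    idealAct (1 : (FractionalIdeal (𝓞 F)⁰ F)ˣ) I = I := by
  refine Subtype.ext ?_
  change embIdeal B ((1 : (FractionalIdeal (𝓞 F)⁰ F)ˣ) : FractionalIdeal (𝓞 F)⁰ F) * I.1 = I.1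
  rw [Units.val_one, embIdeal_one, one_mul]

theorem idealAct_inv_idealAct (𝔞 : (FractionalIdeal (𝓞 F)⁰ F)ˣ) (I : LeftIdeals R) :
    idealAct 𝔞⁻¹ (idealAct 𝔞 I) = I := by
  rw [← idealAct_mul, inv_mul_cancel, idealAct_one]

theorem idealAct_mono (𝔞 : (FractionalIdeal (𝓞 F)⁰ F)ˣ) {I J : LeftIdeals R} (h : I.1 ≤ J.1) :
    (idealAct 𝔞 I).1 ≤ (idealAct 𝔞 J).1 :=
  Submodule.mul_le.2 fun _ hx _ hy => Submodule.mul_mem_mul hx (h hy)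

/-- An `F`-linear `δ` commutes with the scalars in `𝔞`, so the same `δ` serves for both indices. -/
theorem moduleIndex_le_idealAct (𝔞 : (FractionalIdeal (𝓞 F)⁰ F)ˣ) (I J : LeftIdeals R) :
    moduleIndex I.1 J.1 ≤ moduleIndex (idealAct 𝔞 I).1 (idealAct 𝔞 J).1 := by
  refine Submodule.span_mono ?_
  rintro d ⟨δ, hδ, rfl⟩
  refine ⟨δ, fun b hb => ?_, rfl⟩
  refine Submodule.mul_induction_on hb ?_ ?_
  · rintro _ ⟨a, ha, rfl⟩ n hn
    have : δ ((IsScalarTower.toAlgHom (𝓞 F) F B).toLinearMap a * n) =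
        (IsScalarTower.toAlgHom (𝓞 F) F B).toLinearMap a * δ n := by
      change δ (algebraMap F B a * n) = algebraMap F B a * δ n
      rw [← Algebra.smul_def, map_smul, Algebra.smul_def]
    rw [this]
    exact Submodule.mul_mem_mul ⟨a, ha, rfl⟩ (hδ n hn)
  · intro a b ha hb
    rw [map_add]
    exact Submodule.add_mem _ ha hb

theorem moduleIndex_idealAct (𝔞 : (FractionalIdeal (𝓞 F)⁰ F)ˣ) (I J : LeftIdeals R) :
    moduleIndex (idealAct 𝔞 I).1 (idealAct 𝔞 J).1 = moduleIndex I.1 J.1 := by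
  refine le_antisymm ?_ (moduleIndex_le_idealAct 𝔞 I J)
  have := moduleIndex_le_idealAct 𝔞⁻¹ (idealAct 𝔞 I) (idealAct 𝔞 J)
  rwa [idealAct_inv_idealAct, idealAct_inv_idealAct] at this

theorem idealAct_mem_heckeSet {m : Ideal (𝓞 F)} {I J : LeftIdeals R} (h : J ∈ heckeSet m I)
    (𝔞 : (FractionalIdeal (𝓞 F)⁰ F)ˣ) : idealAct 𝔞 J ∈ heckeSet m (idealAct 𝔞 I) :=
  ⟨idealAct_mono 𝔞 h.1, (moduleIndex_idealAct 𝔞 I J).trans h.2⟩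

variable {N : B →* F}

theorem coeSubmodule_sq (m : (Ideal (𝓞 F))⁰) :
    IsLocalization.coeSubmodule F ((m : Ideal (𝓞 F)) ^ 2) =
      (((FractionalIdeal.mk0 F m : (FractionalIdeal (𝓞 F)⁰ F)ˣ) * FractionalIdeal.mk0 F m :
        FractionalIdeal (𝓞 F)⁰ F) : Submodule (𝓞 F) F) := by
  rw [FractionalIdeal.coe_mk0, ← FractionalIdeal.coeIdeal_mul, ← pow_two]
  rfl

/-- If `J ⊆ I` and `[I : J] = m ^ 2`, then `m I ⊆ J` and `[J : m I] = m ^ 2`. -/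
theorem IsReducedNorm.idealAct_mem_heckeSet [Nontrivial B] (hN : IsReducedNorm N)
    (hR : IsOrder R) (m : (Ideal (𝓞 F))⁰) {I J : LeftIdeals R}
    (h : J ∈ heckeSet (m : Ideal (𝓞 F)) I) :
    idealAct (FractionalIdeal.mk0 F m) I ∈ heckeSet (m : Ideal (𝓞 F)) J := by
  obtain ⟨hJI, hidx⟩ := h
  set 𝔪 := FractionalIdeal.mk0 F m
  have key : ∀ p : HeightOneSpectrum (𝓞 F), localAt p (idealAct 𝔪 I).1 ≤ localAt p J.1 ∧
      localAt p (moduleIndex J.1 (idealAct 𝔪 I).1) =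
        localAt p (IsLocalization.coeSubmodule F ((m : Ideal (𝓞 F)) ^ 2)) := by
    intro p
    obtain ⟨a, ha⟩ := I.2.2.2 p
    obtain ⟨b, hb⟩ := J.2.2.2 p
    obtain ⟨ξ, hξB, hξF⟩ := exists_local_generator_sq B 𝔪 p
    have hmI : localAt p (idealAct 𝔪 I).1 = rmul (localAt p R.toSubmodule) (a * scalar B ξ) := by
      change localAt p (embIdeal B _ * I.1) = _
      rw [hξB, ha, rmul_rmul]
    -- The inclusion `J ⊆ I` says that `h = b a⁻¹` is integral at `p`.
    have hh : ((b * a⁻¹ : Bˣ) : B) ∈ localAt p R.toSubmodule := by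
      have h1 : (b : B) ∈ localAt p J.1 := by
        rw [hb, mem_rmul]
        simpa using one_mem_localAt
      have h2 := localAt_mono p hJI h1
      rw [ha, mem_rmul] at h2
      exact h2
    set n := N ((b * a⁻¹ : Bˣ) : B) with hn
    have hn1 : n * N ((a * b⁻¹ : Bˣ) : B) = 1 := by
      rw [hn, show a * b⁻¹ = (b * a⁻¹)⁻¹ by group]
      exact IsReducedNorm.map_units_mul_inv N _
    have hn0 : n ≠ 0 := left_ne_zero_of_mul_eq_one hn1
    have hξ0 : (ξ : F) ≠ 0 := ξ.ne_zero
    -- The index hypothesis at `p`: `n ^ 2` and `ξ ^ 2` generate the same ideal. Taking `c = n ^ 2`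
    -- and `c = ξ ^ 2` below shows that `n` and `ξ` are associates.
    have hloc : ∀ c : F, c * n⁻¹ ^ 2 ∈ localAt p (1 : Submodule (𝓞 F) F) ↔
        c * ((ξ : F)⁻¹) ^ 2 ∈ localAt p (1 : Submodule (𝓞 F) F) := by
      intro c
      rw [← hξF, ← coeSubmodule_sq, ← hidx, hN.mem_localAt_moduleIndex hR I.2.1 ha hb,
        eq_inv_of_mul_eq_one_right hn1]
    have h1 : n * (ξ : F)⁻¹ ∈ localAt p (1 : Submodule (𝓞 F) F) := by
      refine mem_localAt_one_of_pow two_ne_zero ?_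
      rw [mul_pow, ← hloc, ← mul_pow, mul_inv_cancel₀ hn0, one_pow]
      exact isIntegral_mem_localAt_one p isIntegral_one
    have h2 : (ξ : F) * n⁻¹ ∈ localAt p (1 : Submodule (𝓞 F) F) := by
      refine mem_localAt_one_of_pow two_ne_zero ?_
      rw [mul_pow, hloc, ← mul_pow, mul_inv_cancel₀ hξ0, one_pow]
      exact isIntegral_mem_localAt_one p isIntegral_one
    constructor
    · intro y hy
      rw [hmI, mem_rmul] at hy
      rw [hb, mem_rmul]
      -- Since `h⁻¹ = n⁻¹ h̄`, this element is `ξ n⁻¹` times the conjugate of `h`, and both factors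
      -- are integral.
      have hconj : ((scalar B ξ * (b * a⁻¹)⁻¹ : Bˣ) : B) ∈ localAt p R.toSubmodule := by
        have h3 := smul_mem_localAt h2 (hN.conj_mem_localAt hR hh)
        convert h3 using 1
        have h4 := hN.mul_conj ((b * a⁻¹ : Bˣ) : B)
        rw [← hn] at h4
        rw [← (Units.inv_mul_eq_iff_eq_mul _).2 h4.symm, ← Algebra.commutes, ← Algebra.smul_def,
          smul_smul, inv_mul_cancel_right₀ hn0, Units.val_mul, Algebra.smul_def]
        rfl
      have h5 := mul_mem_localAt hy hconj
      convert h5 using 1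
      rw [mul_assoc, ← Units.val_mul]
      congr 2
      rw [← scalar_mul_comm]
      group
    · ext c
      rw [coeSubmodule_sq, hξF, hN.mem_localAt_moduleIndex hR J.2.1 hb hmI]
      -- As `n` is an associate of `ξ`, this norm is an associate of `ξ⁻¹`, so the index of `m I` in
      -- `J` is again generated by `ξ ^ 2`.
      have hNξ : N ((b * (a * scalar B ξ)⁻¹ : Bˣ) : B) = n * (ξ : F)⁻¹ ^ 2 := by
        have h3 : b * (a * scalar B ξ)⁻¹ = scalar B ξ⁻¹ * (b * a⁻¹) := by
          rw [scalar_mul_comm, show scalar B ξ⁻¹ = (scalar B ξ)⁻¹ from map_inv _ _,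
            ← scalar_mul_comm]
          group
        rw [h3, Units.val_mul, map_mul, ← hn, mul_comm]
        congr 1
        refine (hN.map_algebraMap _).trans ?_
        rw [Units.val_inv_eq_inv_val]
      rw [hNξ]
      constructor
      · intro h
        have := localAt_one_mul_mem (localAt_one_mul_mem h h2) h2
        convert this using 1
        field_simp
      · intro h
        have := localAt_one_mul_mem (localAt_one_mul_mem h h1) h1
        convert this using 1
        ring
  exact ⟨le_of_forall_localAt_le fun p => (key p).1,
    le_antisymm (le_of_forall_localAt_le fun p => (key p).2.le)
      (le_of_forall_localAt_le fun p => (key p).2.ge)⟩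

/-- For the converse, the implication applied once more gives `m J ∈ t_m(m I)`, and `m` cancels. -/
theorem IsReducedNorm.mem_heckeSet_iff [Nontrivial B] (hN : IsReducedNorm N)
    (hR : IsOrder R) (m : (Ideal (𝓞 F))⁰) {I J : LeftIdeals R} :
    J ∈ heckeSet (m : Ideal (𝓞 F)) I ↔
      idealAct (FractionalIdeal.mk0 F m) I ∈ heckeSet (m : Ideal (𝓞 F)) J := by
  refine ⟨hN.idealAct_mem_heckeSet hR m, fun h => ?_⟩
  have := QuaternionicModular.idealAct_mem_heckeSet (hN.idealAct_mem_heckeSet hR m h)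
    (FractionalIdeal.mk0 F m)⁻¹
  rwa [idealAct_inv_idealAct, idealAct_inv_idealAct] at this

end Ideals

end LocalIndex

/-! ### Finiteness of transporters and of Hecke sets -/

section Finiteness

variable {F : Type*} [Field F] [NumberField F] {B : Type*} [Ring B] [Algebra F B]
variable {R : Subalgebra (𝓞 F) B}

/-- A local generator at any prime, multiplied by a denominator, will do. -/
theorem LeftIdeals.exists_unit_mem (I : LeftIdeals R) : ∃ g : Bˣ, (g : B) ∈ I.1 := by
  obtain ⟨P, hP⟩ := Ideal.exists_maximal (𝓞 F)
  let p : HeightOneSpectrum (𝓞 F) := ⟨P, hP.isPrime,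
    Ring.ne_bot_of_isMaximal_of_not_isField hP (RingOfIntegers.not_isField F)⟩
  obtain ⟨x, hx⟩ := I.2.2.2 p
  have h1 : (x : B) ∈ localAt p I.1 := by
    rw [hx, mem_rmul]
    simpa using one_mem_localAt
  obtain ⟨s, hs, h⟩ := h1
  have hs0 : algebraMap (𝓞 F) F s ≠ 0 := by
    have : s ≠ 0 := fun h0 => hs (h0 ▸ p.asIdeal.zero_mem)
    simpa using this
  refine ⟨scalar B (Units.mk0 _ hs0) * x, ?_⟩
  rw [Units.val_mul]
  change algebraMap F B (algebraMap (𝓞 F) F s) * (x : B) ∈ _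
  rwa [← Algebra.smul_def, algebraMap_smul]

theorem LeftIdeals.span_eq_top (hR : IsOrder R) (I : LeftIdeals R) :
    Submodule.span F (I.1 : Set B) = ⊤ := by
  obtain ⟨g, hg⟩ := I.exists_unit_mem
  have key : ∀ c ∈ Submodule.span F (R : Set B), c * g ∈ Submodule.span F (I.1 : Set B) := by
    intro c hc
    induction hc using Submodule.span_induction with
    | mem r hr => exact Submodule.subset_span (I.2.2.1 r hr g hg)
    | zero => rw [zero_mul]; exact Submodule.zero_mem _
    | add x y _ _ hx hy => rw [add_mul]; exact Submodule.add_mem _ hx hy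
    | smul a x _ hx => rw [smul_mul_assoc]; exact Submodule.smul_mem _ a hx
  rw [eq_top_iff]
  intro b _
  have := key (b * ((g⁻¹ : Bˣ) : B)) (hR.2 ▸ Submodule.mem_top)
  simpa using this

variable {N : B →* F}

theorem IsReducedNorm.isIntegral_of_rmul_eq (hN : IsReducedNorm N) (hR : IsOrder R)
    {I : LeftIdeals R} {γ : Bˣ} (h : I.rmul γ = I) : IsIntegral (𝓞 F) (N γ) := by
  refine IsIntegral.of_pow two_pos ?_
  rw [← hN.det_mulRight]
  refine isIntegral_det_of_map_le I.2.1 (I.span_eq_top hR) _ fun b hb => ?_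
  rw [← congrArg Subtype.val h]
  exact ⟨b, hb, rfl⟩

/-- Both `γ` and `γ⁻¹` preserve the lattice `I`, so both norms are integral. -/
theorem IsReducedNorm.exists_unit_of_rmul_eq (hN : IsReducedNorm N) (hR : IsOrder R)
    {I : LeftIdeals R} {γ : Bˣ} (h : I.rmul γ = I) :
    ∃ u : (𝓞 F)ˣ, algebraMap (𝓞 F) F u = N γ := by
  have h' : I.rmul γ⁻¹ = I := by
    conv_lhs => rw [← h]
    rw [LeftIdeals.rmul_rmul, mul_inv_cancel, LeftIdeals.rmul_one]
  obtain ⟨a, ha⟩ := IsIntegrallyClosed.isIntegral_iff.1 (hN.isIntegral_of_rmul_eq hR h)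
  obtain ⟨b, hb⟩ := IsIntegrallyClosed.isIntegral_iff.1 (hN.isIntegral_of_rmul_eq hR h')
  have hab : a * b = 1 := by
    apply FaithfulSMul.algebraMap_injective (𝓞 F) F
    rw [map_mul, ha, hb, map_one, IsReducedNorm.map_units_mul_inv]
  exact ⟨Units.mkOfMulEqOne a b hab, ha⟩

/-- The unit group is finitely generated. A unit `v` of `𝓞 F` has reduced norm `v ^ 2`, so modulo
such units only the square class of a unit norm matters. -/
instance finite_units_quotient_squares :
    Finite ((𝓞 F)ˣ ⧸ (powMonoidHom 2 : (𝓞 F)ˣ →* (𝓞 F)ˣ).range) := by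
  have : Group.FG (𝓞 F)ˣ := Group.fg_iff_monoid_fg.2 inferInstance
  have := Subgroup.finiteIndex_range_powMonoidHom_of_fg (𝓞 F)ˣ two_ne_zero
  exact Subgroup.finite_quotient_of_finiteIndex

/-- The transporter of two invertible ideals is finite modulo the units of `𝓞 F` if the norm takes
each value finitely often on each lattice. -/
theorem IsReducedNorm.finite_transporter (hN : IsReducedNorm N) (hR : IsOrder R)
    (hfin : ∀ M : Submodule (𝓞 F) B, M.FG → ∀ c, {y | y ∈ M ∧ N y = c}.Finite)
    (I J : LeftIdeals R) : (unitCls (F := F) '' {x : Bˣ | I.rmul x = J}).Finite := by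
  rcases Set.eq_empty_or_nonempty {x : Bˣ | I.rmul x = J} with h0 | ⟨x₀, hx₀⟩
  · rw [h0, Set.image_empty]
    exact Set.finite_empty
  obtain ⟨g, hg⟩ := I.exists_unit_mem
  -- Relative to a fixed `x₀`, each `x` has norm `u * N x₀` with `u` a unit, and a scalar unit moves
  -- `u` to the representative of its square class. The fixed unit `g` of `I` turns such `x` into
  -- elements `g * x` of the lattice `J` with prescribed norm.
  let Y (q : (𝓞 F)ˣ ⧸ (powMonoidHom 2 : (𝓞 F)ˣ →* (𝓞 F)ˣ).range) : Set Bˣ :=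
    {y | (g : B) * y ∈ J.1 ∧ N ((g : B) * y) = N g * (algebraMap (𝓞 F) F q.out * N x₀)}
  have hY : ∀ q, (Y q).Finite := fun q =>
    (hfin J.1 J.2.1 _).preimage (f := fun y : Bˣ => (g : B) * y)
      fun y _ z _ h => Units.ext (by simpa using h)
  refine (Set.finite_iUnion fun q => (hY q).image (unitCls (F := F))).subset ?_
  rintro _ ⟨x, hx, rfl⟩
  rw [Set.mem_ofPred_eq] at hx hx₀
  have hγ : I.rmul (x * x₀⁻¹) = I := by
    rw [← LeftIdeals.rmul_rmul, hx, ← hx₀, LeftIdeals.rmul_rmul, mul_inv_cancel,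
      LeftIdeals.rmul_one]
  obtain ⟨u, hu⟩ := hN.exists_unit_of_rmul_eq hR hγ
  obtain ⟨v, hv⟩ : (QuotientGroup.mk u :
      (𝓞 F)ˣ ⧸ (powMonoidHom 2 : (𝓞 F)ˣ →* (𝓞 F)ˣ).range).out⁻¹ * u ∈
      (powMonoidHom 2 : (𝓞 F)ˣ →* (𝓞 F)ˣ).range :=
    QuotientGroup.eq.1 (Quotient.out_eq _)
  set q : (𝓞 F)ˣ ⧸ (powMonoidHom 2 : (𝓞 F)ˣ →* (𝓞 F)ˣ).range := QuotientGroup.mk u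
  have hu' : u * (v⁻¹) ^ 2 = q.out := by
    rw [inv_pow, mul_inv_eq_iff_eq_mul]
    exact inv_mul_eq_iff_eq_mul.1 hv.symm
  let w : Bˣ := Units.map (algebraMap (𝓞 F) B : 𝓞 F →* B) v⁻¹
  have hw : ∀ b : B, (w : B) * b = ((v⁻¹ : (𝓞 F)ˣ) : 𝓞 F) • b :=
    fun b => (Algebra.smul_def _ _).symm
  have hNw : N w = algebraMap (𝓞 F) F ((v⁻¹ : (𝓞 F)ˣ) : 𝓞 F) ^ 2 := by
    rw [← hN.map_algebraMap]
    rfl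
  have hNx : N x = algebraMap (𝓞 F) F u * N x₀ := by
    rw [hu, ← map_mul, ← Units.val_mul, inv_mul_cancel_right]
  refine Set.mem_iUnion.2 ⟨q, w * x, ⟨?_, ?_⟩, ?_⟩
  · rw [Units.val_mul, hw, mul_smul_comm]
    refine J.1.smul_mem _ ?_
    rw [← congrArg Subtype.val hx]
    exact ⟨g, hg, rfl⟩
  · rw [map_mul, Units.val_mul, map_mul, hNw, hNx, ← hu']
    push_cast
    ring
  · rw [unitCls_eq_iff, mul_inv_rev, mul_inv_cancel_left, ← map_inv]
    exact ⟨_, rfl⟩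

/-- Such a `J` is determined by its image in `I / m I`, which is a finite module. -/
theorem finite_setOf_le_le (I : LeftIdeals R) (m : (Ideal (𝓞 F))⁰) :
    {J : LeftIdeals R | J.1 ≤ I.1 ∧ (idealAct (FractionalIdeal.mk0 F m) I).1 ≤ J.1}.Finite := by
  have : Finite (𝓞 F ⧸ (m : Ideal (𝓞 F))) :=
    Ideal.finiteQuotientOfFreeOfNeBot _ (nonZeroDivisors.ne_zero m.2)
  let Q : Submodule (𝓞 F) I.1 := (m : Ideal (𝓞 F)) • ⊤
  have : Module.Finite (𝓞 F) I.1 := Module.Finite.iff_fg.2 I.2.1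
  have hQ : Finite (I.1 ⧸ Q) := Submodule.finite_quotient_smul _ Module.Finite.fg_top
  have : Finite (Submodule (𝓞 F) (I.1 ⧸ Q)) := Finite.of_injective _ SetLike.coe_injective
  refine Set.Finite.of_finite_image
    (f := fun J : LeftIdeals R => (J.1.comap I.1.subtype).map Q.mkQ) (Set.toFinite _) ?_
  have key : ∀ J : LeftIdeals R, J.1 ≤ I.1 → (idealAct (FractionalIdeal.mk0 F m) I).1 ≤ J.1 →
      (((J.1.comap I.1.subtype).map Q.mkQ).comap Q.mkQ).map I.1.subtype = J.1 := by
    intro J h1 h2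
    have hQJ : Q ≤ J.1.comap I.1.subtype := by
      rw [Submodule.smul_le]
      rintro r hr n -
      apply h2
      change r • (n : B) ∈ embIdeal B _ * I.1
      rw [Algebra.smul_def]
      exact Submodule.mul_mem_mul ⟨algebraMap (𝓞 F) F r,
        (FractionalIdeal.mem_coeIdeal _).2 ⟨r, hr, rfl⟩, rfl⟩ n.2
    rw [Submodule.comap_map_mkQ, sup_eq_right.2 hQJ, Submodule.map_comap_subtype,
      inf_eq_right.2 h1]
  rintro J ⟨hJ1, hJ2⟩ K ⟨hK1, hK2⟩ h
  refine Subtype.ext ?_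
  rw [← key J hJ1 hJ2, ← key K hK1 hK2]
  exact congrArg (fun L : Submodule (𝓞 F) (I.1 ⧸ Q) => (L.comap Q.mkQ).map I.1.subtype) h

theorem IsReducedNorm.finite_heckeSet [Nontrivial B] (hN : IsReducedNorm N) (hR : IsOrder R)
    (m : (Ideal (𝓞 F))⁰) (I : LeftIdeals R) : (heckeSet (m : Ideal (𝓞 F)) I).Finite :=
  (finite_setOf_le_le I m).subset fun _ hJ => ⟨hJ.1, (hN.idealAct_mem_heckeSet hR m hJ).1⟩

theorem disjoint_unitCls_image {S T : Set Bˣ}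
    (h : ∀ x ∈ S, ∀ y ∈ T, y * x⁻¹ ∉ scalarUnits F B) :
    Disjoint (unitCls (F := F) '' S) (unitCls (F := F) '' T) := by
  rw [Set.disjoint_left]
  rintro _ ⟨x, hx, rfl⟩ ⟨y, hy, hxy⟩
  exact h x hx y hy (unitCls_eq_iff.1 hxy.symm)

theorem LeftIdeals.rmul_of_mem_scalarUnits {z : Bˣ} (hz : z ∈ scalarUnits F B)
    (I : LeftIdeals R) : I.rmul z = I := by
  have key : ∀ z ∈ scalarUnits F B, (I.rmul z).1 ≤ I.1 := by
    rintro _ ⟨u, rfl⟩ _ ⟨b, hb, rfl⟩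
    change b * algebraMap (𝓞 F) B u ∈ I.1
    rw [← Algebra.commutes, ← Algebra.smul_def]
    exact I.1.smul_mem _ hb
  refine Subtype.ext (le_antisymm (key z hz) ?_)
  have := rmul_mono (key z⁻¹ (inv_mem hz)) z
  change ((I.rmul z⁻¹).rmul z).1 ≤ _ at this
  rwa [LeftIdeals.rmul_rmul, inv_mul_cancel, LeftIdeals.rmul_one] at this

end Finiteness

/-! ### Counting, the sesquilinear form and the adjoint -/

section Adjoint

variable {F : Type*} [Field F] [NumberField F] {B : Type*} [Ring B] [Algebra F B]
variable {R : Subalgebra (𝓞 F) B}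

/-- This merges a sum of transporter counts into one count of classes in `(𝓞 F)ˣ \ Bˣ`. Two elements
of one class differ by a scalar unit, which fixes every ideal, so disjointness can be tested on a
single `x`. -/
theorem ncard_biUnion_transporter {ι : Type*} {t : Set ι} (ht : t.Finite) (I J : ι → LeftIdeals R)
    (hfin : ∀ i ∈ t, (unitCls (F := F) '' {x : Bˣ | (I i).rmul x = J i}).Finite)
    (hdisj : ∀ i ∈ t, ∀ j ∈ t, ∀ x : Bˣ, (I i).rmul x = J i → (I j).rmul x = J j → i = j) :
    (unitCls (F := F) '' {x : Bˣ | ∃ i ∈ t, (I i).rmul x = J i}).ncard =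
      ∑ i ∈ ht.toFinset, transporterCount (I i) (J i) := by
  have h1 : unitCls (F := F) '' {x : Bˣ | ∃ i ∈ t, (I i).rmul x = J i} =
      ⋃ i ∈ t, unitCls (F := F) '' {x : Bˣ | (I i).rmul x = J i} := by
    rw [← Set.image_iUnion₂]
    congr 1
    ext x
    simp
  rw [h1, ht.ncard_biUnion hfin, finsum_mem_eq_finite_toFinset_sum _ ht]
  · rfl
  · intro i hi j hj hij
    refine disjoint_unitCls_image fun x hx y hy hz => hij (hdisj i hi j hj x hx ?_)
    rw [Set.mem_ofPred_eq] at hx hy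
    rw [← hy, ← inv_mul_cancel_right y x, ← LeftIdeals.rmul_rmul,
      LeftIdeals.rmul_of_mem_scalarUnits hz]

theorem rmul_eq_iff {I J : LeftIdeals R} {x : Bˣ} : I.rmul x = J ↔ I = J.rmul x⁻¹ := by
  constructor
  · rintro rfl
    rw [LeftIdeals.rmul_rmul, mul_inv_cancel, LeftIdeals.rmul_one]
  · rintro rfl
    rw [LeftIdeals.rmul_rmul, inv_mul_cancel, LeftIdeals.rmul_one]

theorem mem_heckeSet_rmul_inv {m : Ideal (𝓞 F)} {I J : LeftIdeals R} {x : Bˣ} :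
    J.rmul x⁻¹ ∈ heckeSet m I ↔ J ∈ heckeSet m (I.rmul x) := by
  constructor
  · intro h
    have := rmul_mem_heckeSet h x
    rwa [LeftIdeals.rmul_rmul, inv_mul_cancel, LeftIdeals.rmul_one] at this
  · intro h
    have := rmul_mem_heckeSet h x⁻¹
    rwa [LeftIdeals.rmul_rmul I, mul_inv_cancel, LeftIdeals.rmul_one] at this

variable {N : B →* F}

/-- Both sides count the classes of `x` with `J ∈ t_m(I x)`: `x` determines `K = J x⁻¹` on the left
and `K = m I x` on the right, and the duality identifies the two conditions. -/
theorem IsReducedNorm.sum_transporterCount [Nontrivial B] (hN : IsReducedNorm N) (hR : IsOrder R)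
    (hfin : ∀ M : Submodule (𝓞 F) B, M.FG → ∀ c, {y | y ∈ M ∧ N y = c}.Finite)
    (m : (Ideal (𝓞 F))⁰) (I J : LeftIdeals R) :
    ∑ K ∈ (hN.finite_heckeSet hR m I).toFinset, transporterCount K J =
      ∑ K ∈ (hN.finite_heckeSet hR m J).toFinset,
        transporterCount I (idealAct (FractionalIdeal.mk0 F m)⁻¹ K) := by
  set 𝔪 := FractionalIdeal.mk0 F m
  have hact : ∀ K L : LeftIdeals R, K = idealAct 𝔪⁻¹ L ↔ idealAct 𝔪 K = L := by
    intro K L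
    constructor
    · rintro rfl
      rw [← idealAct_mul, mul_inv_cancel, idealAct_one]
    · rintro rfl
      rw [idealAct_inv_idealAct]
  rw [← ncard_biUnion_transporter (hN.finite_heckeSet hR m I) (fun K => K) (fun _ => J)
      (fun K _ => hN.finite_transporter hR hfin K J),
    ← ncard_biUnion_transporter (hN.finite_heckeSet hR m J) (fun _ => I)
      (fun K => idealAct 𝔪⁻¹ K) (fun K _ => hN.finite_transporter hR hfin I _)]
  · congr 2
    ext x
    simp only [Set.mem_ofPred_eq, rmul_eq_iff (J := J), exists_eq_right, hact]
    simp only [exists_eq_right']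
    rw [mem_heckeSet_rmul_inv, hN.mem_heckeSet_iff hR]
  · intro K _ L _ x hK hL
    rw [hact] at hK hL
    rw [← hK, hL]
  · intro K _ L _ x hK hL
    rw [rmul_eq_iff] at hK hL
    rw [hK, hL]

/-- `formInner` as a sesquilinear form. -/
noncomputable def formInnerₛₗ (R : Subalgebra (𝓞 F) B) : Forms R →ₗ⋆[ℂ] Forms R →ₗ[ℂ] ℂ :=
  LinearMap.mk₂'ₛₗ (starRingEnd ℂ) (RingHom.id ℂ) formInner
    (fun u u' v => Finsupp.sum_add_index' (by simp) fun c a b => by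
      rw [← Finsupp.sum_add]
      simp only [map_add, add_mul])
    (fun z u v => by
      unfold formInner
      rw [Finsupp.sum_smul_index' (by simp), Finsupp.smul_sum]
      refine Finsupp.sum_congr fun c _ => ?_
      rw [Finsupp.smul_sum]
      refine Finsupp.sum_congr fun d _ => ?_
      simp only [smul_eq_mul, map_mul]
      ring)
    (fun u v v' => by
      unfold formInner
      rw [← Finsupp.sum_add]
      refine Finsupp.sum_congr fun c _ => Finsupp.sum_add_index' (by simp) fun d a b => ?_
      ring)
    (fun z u v => by
      unfold formInner
      rw [Finsupp.smul_sum]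
      refine Finsupp.sum_congr fun c _ => ?_
      rw [Finsupp.sum_smul_index' (by simp), Finsupp.smul_sum]
      refine Finsupp.sum_congr fun d _ => ?_
      simp only [smul_eq_mul, RingHom.id_apply]
      ring)

theorem formInnerₛₗ_apply (u v : Forms R) : formInnerₛₗ R u v = formInner u v :=
  rfl

theorem formInner_single (c d : IdealClasses R) :
    formInner (Finsupp.single c 1) (Finsupp.single d 1) = (pairing c d : ℂ) := by
  unfold formInner
  rw [Finsupp.sum_single_index (by simp), Finsupp.sum_single_index (by simp)]
  simp

theorem pairing_cls (I J : LeftIdeals R) : pairing (cls I) (cls J) = transporterCount I J :=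
  rfl

theorem pairing_eq_zero {c d : IdealClasses R} (h : c ≠ d) : pairing c d = 0 := by
  obtain ⟨I, rfl⟩ := Quotient.exists_rep c
  obtain ⟨J, rfl⟩ := Quotient.exists_rep d
  change (unitCls (F := F) '' {x : Bˣ | I.rmul x = J}).ncard = 0
  have h0 : {x : Bˣ | I.rmul x = J} = ∅ := by
    refine Set.eq_empty_iff_forall_notMem.2 fun x hx => h ?_
    rw [Set.mem_ofPred_eq] at hx
    rw [← hx]
    exact (cls_rmul I x).symm
  rw [h0, Set.image_empty, Set.ncard_empty]

/-- The transporter contains `x = 1`; finiteness is needed because `Set.ncard` of an infinite set is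
0. -/
theorem IsReducedNorm.pairing_self_ne_zero (hN : IsReducedNorm N) (hR : IsOrder R)
    (hfin : ∀ M : Submodule (𝓞 F) B, M.FG → ∀ c, {y | y ∈ M ∧ N y = c}.Finite)
    (c : IdealClasses R) : pairing c c ≠ 0 := by
  obtain ⟨I, rfl⟩ := Quotient.exists_rep c
  exact ((Set.ncard_pos (hN.finite_transporter hR hfin I I)).2
    ⟨_, 1, LeftIdeals.rmul_one I, rfl⟩).ne'

/-- The Gram matrix is diagonal, so pairing with a basis vector reads off one coordinate up to a
factor. -/
theorem formInner_single_left (c : IdealClasses R) (v : Forms R) :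
    formInner (Finsupp.single c 1) v = v c * pairing c c := by
  unfold formInner
  rw [Finsupp.sum_single_index (by simp), Finsupp.sum, Finset.sum_eq_single c]
  · simp
  · intro d _ hd
    rw [pairing_eq_zero hd.symm]
    simp
  · intro h
    rw [Finsupp.notMem_support_iff.1 h]
    simp

theorem IsReducedNorm.heckeOperator_single [Nontrivial B] (hN : IsReducedNorm N) (hR : IsOrder R)
    (m : (Ideal (𝓞 F))⁰) (I : LeftIdeals R) :
    heckeOperator R m (Finsupp.single (cls I) 1) =
      ∑ K ∈ (hN.finite_heckeSet hR m I).toFinset, Finsupp.single (cls K) 1 := by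
  refine (Finsupp.linearCombination_single ℂ 1 (cls I)).trans ((one_smul _ _).trans ?_)
  exact finsum_mem_eq_finite_toFinset_sum _ _

theorem classOperator_inv_single (m : (Ideal (𝓞 F))⁰) (I : LeftIdeals R) :
    classOperator R (ClassGroup.mk0 m)⁻¹ (Finsupp.single (cls I) 1) =
      Finsupp.single (cls (idealAct (FractionalIdeal.mk0 F m)⁻¹ I)) 1 := by
  rw [classOperator, Finsupp.lmapDomain_apply, Finsupp.mapDomain_single, ← ClassGroup.mk_mk0 F,
    ← map_inv, classAct_mk]

theorem IsReducedNorm.formInner_heckeOperator [Nontrivial B] (hN : IsReducedNorm N)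
    (hR : IsOrder R)
    (hfin : ∀ M : Submodule (𝓞 F) B, M.FG → ∀ c, {y | y ∈ M ∧ N y = c}.Finite)
    (m : (Ideal (𝓞 F))⁰) (u v : Forms R) :
    formInner (heckeOperator R m u) v =
      formInner u (classOperator R (ClassGroup.mk0 m)⁻¹ (heckeOperator R m v)) := by
  simp only [← formInnerₛₗ_apply]
  induction u using Finsupp.induction_linear with
  | zero => simp
  | add u u' hu hu' => simp only [map_add, LinearMap.add_apply, hu, hu']
  | single c a =>
    induction v using Finsupp.induction_linear with
    | zero => simp
    | add v v' hv hv' => simp only [map_add, hv, hv']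
    | single d b =>
      obtain ⟨I, rfl⟩ := Quotient.exists_rep c
      obtain ⟨J, rfl⟩ := Quotient.exists_rep d
      change formInnerₛₗ R (heckeOperator R m (Finsupp.single (cls I) a))
          (Finsupp.single (cls J) b) =
        formInnerₛₗ R (Finsupp.single (cls I) a) (classOperator R (ClassGroup.mk0 m)⁻¹
          (heckeOperator R m (Finsupp.single (cls J) b)))
      rw [← mul_one a, ← mul_one b, ← smul_eq_mul, ← smul_eq_mul, ← Finsupp.smul_single,
        ← Finsupp.smul_single]
      simp only [map_smul, map_smulₛₗ, LinearMap.smul_apply, hN.heckeOperator_single hR, map_sum,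
        LinearMap.sum_apply, classOperator_inv_single, formInnerₛₗ_apply, formInner_single,
        pairing_cls]
      rw [← Finset.smul_sum, ← Nat.cast_sum, ← Nat.cast_sum, hN.sum_transporterCount hR hfin]

end Adjoint

end QuaternionicModular

open QuaternionicModular in
theorem proposition2 {F : Type*} [Field F] [NumberField F] [IsTotallyReal F]
    {B : Type*} [Ring B] [Algebra F B] (hB : IsQuaternionAlgebra F B) (hdef : IsTotallyDefinite F B)
    (R : Subalgebra (𝓞 F) B) (hR : IsEichlerOrder R) (m : (Ideal (𝓞 F))⁰)
    (S : Forms R →ₗ[ℂ] Forms R) :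
    (∀ u v : Forms R, formInner (heckeOperator R m u) v = formInner u (S v)) ↔
      S = classOperator R (ClassGroup.mk0 m)⁻¹ ∘ₗ heckeOperator R m := by
  have : Nontrivial B := by
    obtain ⟨a, b, -, -, ⟨e⟩⟩ := hB
    exact e.injective.nontrivial
  obtain ⟨N, hN, hfin⟩ := exists_isReducedNorm hB hdef
  have hadj := hN.formInner_heckeOperator hR.isOrder hfin m
  constructor
  · intro h
    refine LinearMap.ext fun v => Finsupp.ext fun c => ?_
    -- Testing on a basis vector compares the `c`-coordinates, scaled by the nonzero number `⟨c,
    -- c⟩`.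
    have h1 := (h (Finsupp.single c 1) v).symm.trans (hadj (Finsupp.single c 1) v)
    rw [formInner_single_left, formInner_single_left] at h1
    exact mul_right_cancel₀
      (Nat.cast_ne_zero.2 (hN.pairing_self_ne_zero hR.isOrder hfin c)) h1
  · rintro rfl
    exact hadj
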